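/- Let $R$ be a Noetherian regular local ring of prime characteristic $p$, and let $S=R_\infty$ be its perfect closure, i.e. the ring obtained by adjoining to $R$ the $p^n$-th roots of all its elements, for all $n$. Notation for a commutative ring $A$. For a finite sequence $\underline{x}=x_1,\dots,x_r$ in $A$ let $\mathbb{K}_\bullet(\underline{x})$ be its Koszul complex and $H^i_{\underline{x}}(A)$ the $i$-th cohomology of the Čech complex of $A$ with respect to $\underline{x}$. For an ideal $\mathfrak a$ of $A$ the Koszul grade $\operatorname{K.grade}_A(\mathfrak a,A)\in\mathbb{N}\cup\{\infty\}$ is the supremum, over all finite sequences $\underline{x}$ of elements of $\mathfrak a$, of $\inf\{i\ge 0 : H^i(\operatorname{Hom}_A(\mathbb{K}_\bullet(\underline{x}),A))\ne 0\}$ (with $\inf\emptyset=\infty$). The height $\operatorname{ht}\mathfrak a$ is the infimum of the heights of the primes containing $\mathfrak a$, and $\operatorname{ht}A=\infty$. For a finitely generated ideal $\mathfrak a$, $\mu(\mathfrak a)$ is the minimal number of generators. A prime is weakly associated to an $A$-module $M$ if it is minimal over $(0:_A m)$ for some $m\in M$; the set of these primes is $\operatorname{wAss}_A M$. The sequence $\underline{x}$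 is weakly proregular if for each $n>0$ there is $m\ge n$ such that the map $H_i(\mathbb{K}_\bullet(\underline{x}^m))\to H_i(\mathbb{K}_\bullet(\underline{x}^n))$, induced by $e_j\mapsto x_j^{m-n}e_j$, is zero for all $i\ge1$. A sequence $\underline{x}=x_1,\dots,x_\ell$ is a parameter sequence if it is weakly proregular, $(\underline{x})A\ne A$, and $H^\ell_{\underline{x}}(A)_{\mathfrak p}\ne0$ for all primes $\mathfrak p\supseteq(\underline{x})$; it is a strong parameter sequence if $x_1,\dots,x_i$ is a parameter sequence for all $1\le i\le\ell$. Then $S$ is Cohen–Macaulay in each of the following senses. 1. (Hamilton–Marley) Every strong parameter sequence on $S$ is a regular sequence on $S$. 2. (Glaz) $\operatorname{ht}\mathfrak p=\operatorname{K.grade}_{S_{\mathfrak p}}(\mathfrak pS_{\mathfrak p},S_{\mathfrak p})$ for every prime ideal $\mathfrak p$ of $S$. 3. (Weak Bourbaki unmixed) For every finitely generated ideal $\mathfrak a$ of $S$ with $\operatorname{ht}\mathfrak a\ge\mu(\mathfrak a)$, the set of minimal primes of $\mathfrak a$ equals $\operatorname{wAss}_S(S/\mathfrak a)$. 4. For every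 non-empty class $\mathcal A$ of ideals of $S$, $\operatorname{ht}\mathfrak a=\operatorname{K.grade}_S(\mathfrak a,S)$ for all $\mathfrak a\in\mathcal A$; in particular this holds for the class of prime ideals, of maximal ideals, of all ideals, and of finitely generated ideals of $S$. -/

import Mathlib

noncomputable section

namespace NonNoetherianCM

universe u v

section Koszul

variable {R : Type u} [CommRing R] {r : ℕ}

/-- The differential `K_{k+1}(x) → K_k(x)` of the Koszul complex `K_•(x)`, where
`K_k(x) = ⋀^k R^r`:
`v₀ ∧ ⋯ ∧ v_k ↦ ∑ i, (-1)^i (∑ j, x_j (v_i)_j) • v₀ ∧ ⋯ ∧ v̂_i ∧ ⋯ ∧ v_k`. -/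
def koszulD (x : Fin r → R) (k : ℕ) :
    ⋀[R]^(k + 1) (Fin r → R) →ₗ[R] ⋀[R]^k (Fin r → R) :=
  exteriorPower.alternatingMapLinearEquiv
    (AlternatingMap.alternatizeUncurryFin
      ((Fintype.linearCombination R x).smulRight (exteriorPower.ιMulti R k)))

theorem koszulD_ιMulti (x : Fin r → R) (k : ℕ) (v : Fin (k + 1) → Fin r → R) :
    koszulD x k (exteriorPower.ιMulti R (k + 1) v) =
      ∑ i : Fin (k + 1), (-1 : ℤ) ^ (i : ℕ) •
        ((∑ j, v i j * x j) • exteriorPower.ιMulti R k (i.removeNth v)) := by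
  simp [koszulD, AlternatingMap.alternatizeUncurryFin_apply, Fintype.linearCombination_apply]

theorem koszulD_comp_koszulD (x : Fin r → R) (k : ℕ) :
    koszulD x k ∘ₗ koszulD x (k + 1) = 0 := by
  apply exteriorPower.linearMap_ext
  have h := AlternatingMap.alternatizeUncurryFin_alternatizeUncurryFinLM_comp_of_symmetric
    (f := (Fintype.linearCombination R x).smulRight
      ((Fintype.linearCombination R x).smulRight (exteriorPower.ιMulti R k (M := Fin r → R))))
    (by intro a b; simp [smul_smul, mul_comm])
  ext v : 1
  have h2 := congrArg (fun f => f v) h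
  simp only [LinearMap.compAlternatingMap_apply, LinearMap.comp_apply, koszulD_ιMulti, map_sum,
    map_zsmul, map_smul]
  simpa [AlternatingMap.alternatizeUncurryFin_apply, Fintype.linearCombination_apply] using h2

/-- The coboundary `Hom(K_k(x), M) → Hom(K_{k+1}(x), M)`. -/
def koszulCoboundary (x : Fin r → R) (M : Type v) [AddCommGroup M] [Module R M] (k : ℕ) :
    (⋀[R]^k (Fin r → R) →ₗ[R] M) →ₗ[R] (⋀[R]^(k + 1) (Fin r → R) →ₗ[R] M) :=
  LinearMap.lcomp R M (koszulD x k)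

/-- The submodule of `i`-coboundaries of `Hom(K_•(x), M)`. -/
def koszulBoundaries (x : Fin r → R) (M : Type v) [AddCommGroup M] [Module R M] :
    (i : ℕ) → Submodule R (⋀[R]^i (Fin r → R) →ₗ[R] M)
  | 0 => ⊥
  | k + 1 => LinearMap.range (koszulCoboundary x M k)

/-- The Koszul cohomology module `H^i(Hom(K_•(x), M))`. -/
abbrev KoszulCohomology (x : Fin r → R) (M : Type v) [AddCommGroup M] [Module R M] (i : ℕ) :
    Type (max u v) :=
  LinearMap.ker (koszulCoboundary x M i) ⧸
    (koszulBoundaries x M i).submoduleOf (LinearMap.ker (koszulCoboundary x M i))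

/-- `inf {i | H^i(Hom(K_•(x), M)) ≠ 0}`, with `inf ∅ = ∞`. -/
def koszulGradeSeq (x : Fin r → R) (M : Type v) [AddCommGroup M] [Module R M] : ℕ∞ :=
  ⨅ (i : ℕ) (_ : Nontrivial (KoszulCohomology x M i)), (i : ℕ∞)

/-- The Koszul grade `K.grade_R(a, M)`: the supremum of the Koszul grades of the finitely
generated subideals of `a`. Each of those is given by a finite generating sequence, so the
supremum runs over all finite sequences of elements of `a`. -/
def koszulGrade (a : Ideal R) (M : Type v) [AddCommGroup M] [Module R M] : ℕ∞ :=
  ⨆ (r : ℕ) (x : Fin r → R) (_ : ∀ i, x i ∈ a), koszulGradeSeq x M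

/-- The map `K_k(x^m) → K_k(x^n)` (for `m ≥ n`), induced on exterior powers by
`e_i ↦ x_i^(m-n) e_i`. -/
def koszulPowMap (x : Fin r → R) (m n k : ℕ) :
    ⋀[R]^k (Fin r → R) →ₗ[R] ⋀[R]^k (Fin r → R) :=
  exteriorPower.map k (LinearMap.pi fun i => (x i ^ (m - n)) • LinearMap.proj i)

/-- The maps `K_k(x^m) → K_k(x^n)` form a chain map. -/
theorem koszulD_comp_koszulPowMap (x : Fin r → R) {m n : ℕ} (h : n ≤ m) (k : ℕ) :
    koszulD (fun i => x i ^ n) k ∘ₗ koszulPowMap x m n (k + 1) =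
      koszulPowMap x m n k ∘ₗ koszulD (fun i => x i ^ m) k := by
  apply exteriorPower.linearMap_ext
  ext v : 1
  simp only [LinearMap.compAlternatingMap_apply, LinearMap.comp_apply, koszulPowMap,
    exteriorPower.map_apply_ιMulti, koszulD_ιMulti, map_sum, map_zsmul, map_smul]
  refine Finset.sum_congr rfl fun i _ => ?_
  congr 2
  refine Finset.sum_congr rfl fun j _ => ?_
  simp only [Function.comp, LinearMap.pi_apply, LinearMap.smul_apply, LinearMap.proj_apply,
    smul_eq_mul]
  rw [← Nat.sub_add_cancel h, pow_add]
  simp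
  ring

/-- `x` is weakly proregular: for every `n > 0` there is `m ≥ n` such that
`H_i(K_•(x^m)) → H_i(K_•(x^n))` is zero for all `i ≥ 1` (here `i = k + 1`), that is, every
`i`-cycle of `K_•(x^m)` is mapped to an `i`-boundary of `K_•(x^n)`. -/
def IsWeaklyProregular (x : Fin r → R) : Prop :=
  ∀ n : ℕ, 0 < n → ∃ m : ℕ, n ≤ m ∧ ∀ k : ℕ,
    ∀ z : ⋀[R]^(k + 1) (Fin r → R), koszulD (fun i => x i ^ m) k z = 0 →
      koszulPowMap x m n (k + 1) z ∈ LinearMap.range (koszulD (fun i => x i ^ n) (k + 1))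

end Koszul

section Cech

variable {R : Type u} [CommRing R] {r : ℕ}

/-- The ring `R_{x_I}`, the localization of `R` at `∏ i ∈ I, x i`. -/
abbrev CechTerm (x : Fin r → R) (I : Finset (Fin r)) : Type u :=
  Localization.Away (∏ i ∈ I, x i)

theorem isUnit_cechTerm (x : Fin r → R) {I J : Finset (Fin r)} (h : I ⊆ J) :
    IsUnit (Algebra.ofId R (CechTerm x J) (∏ i ∈ I, x i)) :=
  isUnit_of_dvd_unit (map_dvd _ (Finset.prod_dvd_prod_of_subset _ _ _ h))
    (IsLocalization.Away.algebraMap_isUnit (∏ i ∈ J, x i))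

/-- The canonical map `R_{x_I} → R_{x_J}` for `I ⊆ J`. -/
def cechRestrict (x : Fin r → R) {I J : Finset (Fin r)} (h : I ⊆ J) :
    CechTerm x I →ₐ[R] CechTerm x J :=
  IsLocalization.Away.liftAlgHom (∏ i ∈ I, x i) (isUnit_cechTerm x h)

/-- The `k`-th term `⨁_{|I| = k} R_{x_I}` of the Čech complex of `R` with respect to `x`. -/
abbrev CechCochain (x : Fin r → R) (k : ℕ) : Type u :=
  (I : {I : Finset (Fin r) // I.card = k}) → CechTerm x I.1

/-- The differential of the Čech complex:
`(d c)_J = ∑_{j ∈ J} (-1)^{#{i ∈ J | i < j}} c_{J \ {j}}`. -/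
def cechD (x : Fin r → R) (k : ℕ) : CechCochain x k →ₗ[R] CechCochain x (k + 1) :=
  LinearMap.pi fun J => ∑ j : J.1,
    (-1 : ℤ) ^ ({i ∈ J.1 | i < j.1} : Finset (Fin r)).card •
      ((cechRestrict x (Finset.erase_subset j.1 J.1)).toLinearMap ∘ₗ
        LinearMap.proj (φ := fun I : {I : Finset (Fin r) // I.card = k} => CechTerm x I.1)
          ⟨J.1.erase j.1, by rw [Finset.card_erase_of_mem j.2, J.2, Nat.add_sub_cancel]⟩)

/-- The submodule of `i`-coboundaries of the Čech complex. -/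
def cechBoundaries (x : Fin r → R) : (i : ℕ) → Submodule R (CechCochain x i)
  | 0 => ⊥
  | k + 1 => LinearMap.range (cechD x k)

/-- The Čech cohomology module `H^i_x(R)`. -/
abbrev CechCohomology (x : Fin r → R) (i : ℕ) : Type u :=
  LinearMap.ker (cechD x i) ⧸ (cechBoundaries x i).submoduleOf (LinearMap.ker (cechD x i))

end Cech

section CohenMacaulay

variable {R : Type u} [CommRing R]

/-- `x₁, …, x_ℓ` is a parameter sequence on `R`: it is weakly proregular, generates a proper
ideal, and `H^ℓ_x(R)_p ≠ 0` for every prime `p ⊇ (x)`. -/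
structure IsParameterSequence {l : ℕ} (x : Fin l → R) : Prop where
  weaklyProregular : IsWeaklyProregular x
  span_ne_top : Ideal.span (Set.range x) ≠ ⊤
  cech_ne_zero : ∀ (p : Ideal R) [p.IsPrime], Ideal.span (Set.range x) ≤ p →
    Nontrivial (LocalizedModule p.primeCompl (CechCohomology x l))

/-- `x₁, …, x_i` is a parameter sequence for each `1 ≤ i ≤ ℓ`. -/
def IsStrongParameterSequence {l : ℕ} (x : Fin l → R) : Prop :=
  ∀ (i : ℕ) (h : i ≤ l), 1 ≤ i → IsParameterSequence fun j : Fin i => x (Fin.castLE h j)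

/-- The weakly associated primes of `M`: the primes minimal over `(0 :_R m)` for some `m : M`. -/
def weaklyAssociatedPrimes (R : Type u) [CommRing R] (M : Type v) [AddCommGroup M] [Module R M] :
    Set (Ideal R) :=
  {p | ∃ m : M, p ∈ Ideal.minimalPrimes (LinearMap.ker (LinearMap.toSpanSingleton R M m))}

variable (R)

/-- Cohen-Macaulay in the sense of Hamilton-Marley. -/
def IsHamiltonMarleyCM : Prop :=
  ∀ (l : ℕ) (x : Fin l → R), IsStrongParameterSequence x →
    RingTheory.Sequence.IsRegular R (List.ofFn x)

/-- Cohen-Macaulay in the sense of Glaz. -/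
def IsGlazCM : Prop :=
  ∀ (p : Ideal R) [p.IsPrime],
    p.height = koszulGrade (p.map (algebraMap R (Localization.AtPrime p)))
      (Localization.AtPrime p)

/-- Weak Bourbaki unmixed. For a finitely generated ideal, `Submodule.spanFinrank` is the minimal
number of generators. -/
def IsWeakBourbakiUnmixed : Prop :=
  ∀ a : Ideal R, a.FG → (a.spanFinrank : ℕ∞) ≤ a.height →
    a.minimalPrimes = weaklyAssociatedPrimes R (R ⧸ a)

variable {R}

/-- Cohen-Macaulay in the sense of a class `𝒜` of ideals of `R`. -/
def IsCMInSenseOf (𝒜 : Set (Ideal R)) : Prop :=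
  ∀ a ∈ 𝒜, a.height = koszulGrade a R

end CohenMacaulay

end NonNoetherianCM

end

/-!
In a Noetherian local ring `R` whose maximal ideal has Koszul grade at least its height, every
sequence generating a proper ideal of height at least its length is weakly regular. This property
passes to `S`: a Frobenius power of a given sequence of `S` comes from `R`, with the same length
and, `Spec S → Spec R` being a homeomorphism, the same height. All Frobenius powers of the sequence
so obtained are then weakly regular on `R`, and since `S` is the union of the rings
`R ^ (1 / p ^ n)`, the sequence is weakly regular on `S`; taking `p`-th roots is an automorphism of
`S`.

The senses of Cohen–Macaulayness follow formally, as `Spec S` is Noetherian of finite dimension: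
prime avoidance produces weakly regular sequences as long as the height of a given ideal, the Koszul
grade of an ideal below a minimal prime of a weakly regular sequence is at most its length, and the
top Čech cohomology vanishes at `P` when the last element is nilpotent modulo the others up to a
multiplier outside `P`.
-/

noncomputable section

namespace NonNoetherianCM

universe u v

open RingTheory.Sequence IsLocalRing Filter TopologicalSpace
open scoped Pointwise

section KoszulGrade

variable {A : Type u} [CommRing A] {r : ℕ} {x : Fin r → A}
  {M : Type v} [AddCommGroup M] [Module A M]

theorem mem_koszulBoundaries_succ {k : ℕ} {φ : ⋀[A]^(k + 1) (Fin r → A) →ₗ[A] M} :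
    φ ∈ koszulBoundaries x M (k + 1) ↔ ∃ ψ : ⋀[A]^k (Fin r → A) →ₗ[A] M, ψ ∘ₗ koszulD x k = φ :=
  Iff.rfl

theorem mem_koszulBoundaries_zero {φ : ⋀[A]^0 (Fin r → A) →ₗ[A] M} :
    φ ∈ koszulBoundaries x M 0 ↔ φ = 0 :=
  Iff.rfl

theorem subsingleton_koszulCohomology_iff {i : ℕ} :
    Subsingleton (KoszulCohomology x M i) ↔
      ∀ φ : ⋀[A]^i (Fin r → A) →ₗ[A] M, φ ∘ₗ koszulD x i = 0 → φ ∈ koszulBoundaries x M i := by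
  rw [Submodule.Quotient.subsingleton_iff, Submodule.submoduleOf, Submodule.comap_subtype_eq_top]
  rfl

theorem natCast_le_koszulGradeSeq_iff {n : ℕ} :
    (n : ℕ∞) ≤ koszulGradeSeq x M ↔
      ∀ i < n, ∀ φ : ⋀[A]^i (Fin r → A) →ₗ[A] M, φ ∘ₗ koszulD x i = 0 →
        φ ∈ koszulBoundaries x M i := by
  simp only [koszulGradeSeq, le_iInf_iff, ← subsingleton_koszulCohomology_iff, Nat.cast_le]
  refine forall_congr' fun i => ?_
  rw [← not_subsingleton_iff_nontrivial, ← not_imp_not, not_not, not_le]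

theorem koszulBoundaries_comp_koszulD {i : ℕ} {φ : ⋀[A]^i (Fin r → A) →ₗ[A] M}
    (h : φ ∈ koszulBoundaries x M i) : φ ∘ₗ koszulD x i = 0 := by
  cases i with
  | zero => rw [mem_koszulBoundaries_zero.1 h, LinearMap.zero_comp]
  | succ k =>
    obtain ⟨ψ, rfl⟩ := mem_koszulBoundaries_succ.1 h
    rw [LinearMap.comp_assoc, koszulD_comp_koszulD, LinearMap.comp_zero]

theorem comp_mem_koszulBoundaries {N : Type*} [AddCommGroup N] [Module A N] (g : M →ₗ[A] N)
    {i : ℕ} {φ : ⋀[A]^i (Fin r → A) →ₗ[A] M} (h : φ ∈ koszulBoundaries x M i) :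
    g ∘ₗ φ ∈ koszulBoundaries x N i := by
  cases i with
  | zero => simp [mem_koszulBoundaries_zero.1 h]
  | succ k =>
    obtain ⟨ψ, rfl⟩ := mem_koszulBoundaries_succ.1 h
    exact ⟨g ∘ₗ ψ, rfl⟩

theorem koszulGradeSeq_le_of_linearEquiv {N : Type*} [AddCommGroup N] [Module A N]
    (e : M ≃ₗ[A] N) : koszulGradeSeq x M ≤ koszulGradeSeq x N := by
  refine ENat.forall_natCast_le_iff_le.1 fun n hn =>
    natCast_le_koszulGradeSeq_iff.2 fun i hi φ hφ => ?_
  have h := comp_mem_koszulBoundaries e.toLinearMap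
    (natCast_le_koszulGradeSeq_iff.1 hn i hi (e.symm.toLinearMap ∘ₗ φ)
      (by rw [LinearMap.comp_assoc, hφ, LinearMap.comp_zero]))
  rwa [← LinearMap.comp_assoc, LinearEquiv.comp_symm, LinearMap.id_comp] at h

theorem exists_eq_smul_of_mkQ_comp_eq_zero {P : Type*} [AddCommGroup P] [Module A P]
    [Module.Projective A P] (y : A) (φ : P →ₗ[A] M)
    (h : (y • (⊤ : Submodule A M)).mkQ ∘ₗ φ = 0) : ∃ ψ : P →ₗ[A] M, φ = y • ψ := by
  have hmem (a : P) : φ a ∈ LinearMap.range (LinearMap.lsmul A M y) := by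
    have ha : φ a ∈ y • (⊤ : Submodule A M) :=
      (Submodule.Quotient.mk_eq_zero _).1 (LinearMap.congr_fun h a)
    obtain ⟨m, -, hm⟩ := ha
    exact ⟨m, hm⟩
  obtain ⟨ψ, hψ⟩ := Module.projective_lifting_property (LinearMap.lsmul A M y).rangeRestrict
    (φ.codRestrict _ hmem) (LinearMap.surjective_rangeRestrict _)
  exact ⟨ψ, LinearMap.ext fun a => congrArg Subtype.val (LinearMap.congr_fun hψ a).symm⟩

theorem mkQ_comp_smul_eq_zero {P : Type*} [AddCommGroup P] [Module A P] (y : A)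
    (φ : P →ₗ[A] M) : (y • (⊤ : Submodule A M)).mkQ ∘ₗ (y • φ) = 0 :=
  LinearMap.ext fun _ => (Submodule.Quotient.mk_eq_zero _).2
    (Submodule.smul_mem_pointwise_smul _ _ _ trivial)

theorem smul_linearMap_injective {P : Type*} [AddCommGroup P] [Module A P] {y : A}
    (hy : IsSMulRegular M y) : Function.Injective fun φ : P →ₗ[A] M => y • φ :=
  fun _ _ h => LinearMap.ext fun a => hy (LinearMap.congr_fun h a)

theorem exists_sub_smul_mem_koszulBoundaries {y : A} {k : ℕ} {φ : ⋀[A]^k (Fin r → A) →ₗ[A] M}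
    (h : (y • (⊤ : Submodule A M)).mkQ ∘ₗ φ ∈ koszulBoundaries x (QuotSMulTop y M) k) :
    ∃ ψ : ⋀[A]^k (Fin r → A) →ₗ[A] M, φ - y • ψ ∈ koszulBoundaries x M k := by
  obtain ⟨θ, hθ, hφθ⟩ : ∃ θ ∈ koszulBoundaries x M k,
      (y • (⊤ : Submodule A M)).mkQ ∘ₗ (φ - θ) = 0 := by
    cases k with
    | zero => exact ⟨0, zero_mem _, by simpa using mem_koszulBoundaries_zero.1 h⟩
    | succ l =>
      obtain ⟨χ, hχ⟩ := mem_koszulBoundaries_succ.1 h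
      obtain ⟨χ', rfl⟩ := Module.projective_lifting_property
        (y • (⊤ : Submodule A M)).mkQ χ (Submodule.mkQ_surjective _)
      exact ⟨χ' ∘ₗ koszulD x l, ⟨χ', rfl⟩, by
        rw [LinearMap.comp_sub, ← LinearMap.comp_assoc, hχ, sub_self]⟩
  obtain ⟨ψ, hψ⟩ := exists_eq_smul_of_mkQ_comp_eq_zero y _ hφθ
  exact ⟨ψ, by rwa [← hψ, sub_sub_cancel]⟩

theorem koszulGradeSeq_le_quotSMulTop_add_one {y : A} (hy : IsSMulRegular M y) :
    koszulGradeSeq x M ≤ koszulGradeSeq x (QuotSMulTop y M) + 1 := by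
  refine ENat.forall_natCast_le_iff_le.1 fun n hn => ?_
  cases n with
  | zero => exact zero_le
  | succ n =>
  rw [natCast_le_koszulGradeSeq_iff] at hn
  push_cast
  gcongr
  refine natCast_le_koszulGradeSeq_iff.2 fun i hi φ hφ => ?_
  obtain ⟨φ, rfl⟩ := Module.projective_lifting_property (y • (⊤ : Submodule A M)).mkQ φ
    (Submodule.mkQ_surjective _)
  obtain ⟨ψ, hψ⟩ := exists_eq_smul_of_mkQ_comp_eq_zero y (φ ∘ₗ koszulD x i) hφ
  have hψ_cocycle : ψ ∘ₗ koszulD x (i + 1) = 0 := by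
    apply smul_linearMap_injective hy
    dsimp only
    rw [smul_zero, ← LinearMap.smul_comp, ← hψ, LinearMap.comp_assoc, koszulD_comp_koszulD,
      LinearMap.comp_zero]
  obtain ⟨χ, hχ⟩ := mem_koszulBoundaries_succ.1 (hn (i + 1) (by omega) ψ hψ_cocycle)
  have hφχ : φ - y • χ ∈ koszulBoundaries x M i := hn i (by omega) _ (by
    rw [LinearMap.sub_comp, hψ, LinearMap.smul_comp, hχ, sub_self])
  simpa only [LinearMap.comp_sub, mkQ_comp_smul_eq_zero, sub_zero] using
    comp_mem_koszulBoundaries (y • (⊤ : Submodule A M)).mkQ hφχ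

theorem koszulGradeSeq_le_quotient_add_length {rs : List A} (hrs : IsWeaklyRegular M rs) :
    koszulGradeSeq x M ≤
      koszulGradeSeq x (M ⧸ Ideal.ofList rs • (⊤ : Submodule A M)) + rs.length := by
  induction rs generalizing M with
  | nil =>
    simpa using koszulGradeSeq_le_of_linearEquiv
      (Submodule.quotEquivOfEqBot (Ideal.ofList [] • (⊤ : Submodule A M)) (by simp)).symm
  | cons y rs ih =>
    obtain ⟨hy, hrs⟩ := (isWeaklyRegular_cons_iff M y rs).1 hrs
    calc koszulGradeSeq x M
        ≤ koszulGradeSeq x (QuotSMulTop y M) + 1 := koszulGradeSeq_le_quotSMulTop_add_one hy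
      _ ≤ koszulGradeSeq x (_ ⧸ Ideal.ofList rs • (⊤ : Submodule A (QuotSMulTop y M)))
            + rs.length + 1 := by gcongr; exact ih hrs
      _ ≤ _ := by
        rw [List.length_cons, Nat.cast_add, Nat.cast_one, ← add_assoc]
        gcongr
        exact koszulGradeSeq_le_of_linearEquiv
          (Submodule.quotOfListConsSMulTopEquivQuotSMulTopInner M y rs).symm

/-- Left exterior multiplication by `v`, a contracting homotopy of the Koszul complex up to the
factor `∑ j, v j * x j`. -/
def wedgeLeft (v : Fin r → A) (k : ℕ) : ⋀[A]^k (Fin r → A) →ₗ[A] ⋀[A]^(k + 1) (Fin r → A) :=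
  exteriorPower.alternatingMapLinearEquiv ((exteriorPower.ιMulti A (k + 1)).curryLeft v)

theorem wedgeLeft_ιMulti (v : Fin r → A) (k : ℕ) (w : Fin k → Fin r → A) :
    wedgeLeft v k (exteriorPower.ιMulti A k w) =
      exteriorPower.ιMulti A (k + 1) (Matrix.vecCons v w) := by
  simp [wedgeLeft]

theorem koszulD_comp_wedgeLeft_zero (x v : Fin r → A) :
    koszulD x 0 ∘ₗ wedgeLeft v 0 = (∑ j, v j * x j) • LinearMap.id := by
  apply exteriorPower.linearMap_ext
  ext w : 1
  simp only [LinearMap.compAlternatingMap_apply, LinearMap.comp_apply, wedgeLeft_ιMulti,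
    koszulD_ιMulti, LinearMap.smul_apply, LinearMap.id_apply, Fin.sum_univ_succ,
    Fin.sum_univ_zero, add_zero, Fin.val_zero, pow_zero, one_smul, Matrix.cons_val_zero]
  rfl

theorem removeNth_succ_vecCons {α : Type*} {k : ℕ} (v : α) (w : Fin (k + 1) → α)
    (i : Fin (k + 1)) :
    Fin.removeNth (α := fun _ => α) i.succ (Matrix.vecCons v w) =
      Matrix.vecCons v (Fin.removeNth (α := fun _ => α) i w) := by
  funext j
  cases j using Fin.cases <;> simp [Fin.removeNth]

theorem koszulD_comp_wedgeLeft_succ (x v : Fin r → A) (k : ℕ) :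
    koszulD x (k + 1) ∘ₗ wedgeLeft v (k + 1) + wedgeLeft v k ∘ₗ koszulD x k =
      (∑ j, v j * x j) • LinearMap.id := by
  apply exteriorPower.linearMap_ext
  ext w : 1
  simp only [LinearMap.compAlternatingMap_apply, LinearMap.comp_apply, LinearMap.add_apply,
    wedgeLeft_ιMulti, koszulD_ιMulti, LinearMap.smul_apply, LinearMap.id_apply, map_sum, map_zsmul,
    map_smul]
  rw [Fin.sum_univ_succ, add_assoc, ← Finset.sum_add_distrib]
  refine (congrArg₂ (· + ·) ?_ (Finset.sum_eq_zero fun i _ => ?_)).trans (add_zero _)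
  · simp only [Fin.val_zero, pow_zero, one_smul, Matrix.cons_val_zero]
    rfl
  · rw [removeNth_succ_vecCons]
    simp [pow_succ]

theorem smul_mem_koszulBoundaries {y : A} (hy : y ∈ Ideal.span (Set.range x)) {i : ℕ}
    {φ : ⋀[A]^i (Fin r → A) →ₗ[A] M} (hφ : φ ∘ₗ koszulD x i = 0) :
    y • φ ∈ koszulBoundaries x M i := by
  obtain ⟨v, rfl⟩ := Ideal.mem_span_range_iff_exists_fun.1 hy
  cases i with
  | zero =>
    have h := congrArg (fun f => φ ∘ₗ f) (koszulD_comp_wedgeLeft_zero x v)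
    simp only [← LinearMap.comp_assoc, hφ, LinearMap.zero_comp, LinearMap.comp_smul,
      LinearMap.comp_id] at h
    exact mem_koszulBoundaries_zero.2 h.symm
  | succ k =>
    have h := congrArg (fun f => φ ∘ₗ f) (koszulD_comp_wedgeLeft_succ x v k)
    simp only [LinearMap.comp_add, ← LinearMap.comp_assoc, hφ, LinearMap.zero_comp,
      LinearMap.comp_smul, LinearMap.comp_id, zero_add] at h
    exact mem_koszulBoundaries_succ.2 ⟨_, h⟩

theorem quotSMulTop_koszulGradeSeq_add_one_le {y : A} (hy : IsSMulRegular M y)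
    (hyx : y ∈ Ideal.span (Set.range x)) :
    koszulGradeSeq x (QuotSMulTop y M) + 1 ≤ koszulGradeSeq x M := by
  refine ENat.forall_natCast_le_iff_le.1 fun n hn =>
    natCast_le_koszulGradeSeq_iff.2 fun i hi φ hφ => ?_
  have hyφ := smul_mem_koszulBoundaries hyx hφ
  cases i with
  | zero =>
    exact smul_linearMap_injective hy (hyφ.trans (smul_zero y).symm)
  | succ k =>
    obtain ⟨ψ, hψ⟩ := mem_koszulBoundaries_succ.1 hyφ
    have hk : ((k + 1 : ℕ) : ℕ∞) ≤ koszulGradeSeq x (QuotSMulTop y M) := by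
      have h : ((k + 1 + 1 : ℕ) : ℕ∞) ≤ n := by exact_mod_cast hi
      exact (ENat.add_le_add_iff_right ENat.one_ne_top).1 (by exact_mod_cast h.trans hn)
    have hψ_boundary := natCast_le_koszulGradeSeq_iff.1 hk k k.lt_succ_self
      ((y • (⊤ : Submodule A M)).mkQ ∘ₗ ψ)
      (by rw [LinearMap.comp_assoc, hψ, mkQ_comp_smul_eq_zero])
    obtain ⟨θ, hθ⟩ := exists_sub_smul_mem_koszulBoundaries hψ_boundary
    refine mem_koszulBoundaries_succ.2 ⟨θ, smul_linearMap_injective hy ?_⟩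
    have h := koszulBoundaries_comp_koszulD hθ
    rw [LinearMap.sub_comp, hψ, LinearMap.smul_comp, sub_eq_zero] at h
    exact h.symm

theorem length_le_koszulGradeSeq {rs : List A} (hx : Ideal.ofList rs ≤ Ideal.span (Set.range x))
    (hrs : IsWeaklyRegular M rs) : (rs.length : ℕ∞) ≤ koszulGradeSeq x M := by
  induction rs generalizing M with
  | nil => exact zero_le
  | cons y rs ih =>
    obtain ⟨hy, hrs⟩ := (isWeaklyRegular_cons_iff M y rs).1 hrs
    rw [Ideal.ofList_cons, sup_le_iff, Ideal.span_singleton_le_iff_mem] at hx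
    push_cast [List.length_cons]
    exact (add_le_add_left (ih hx.2 hrs) 1).trans (quotSMulTop_koszulGradeSeq_add_one_le hy hx.1)

theorem koszulGradeSeq_le_koszulGrade {a : Ideal A} (hx : ∀ j, x j ∈ a) :
    koszulGradeSeq x M ≤ koszulGrade a M :=
  le_iSup₂_of_le r x (le_iSup_of_le hx le_rfl)

theorem length_le_koszulGrade {a : Ideal A} {rs : List A} (ha : Ideal.ofList rs ≤ a)
    (hrs : IsWeaklyRegular M rs) : (rs.length : ℕ∞) ≤ koszulGrade a M := by
  have hx : Ideal.ofList rs ≤ Ideal.span (Set.range rs.get) := by rw [Set.range_list_get]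
  exact (length_le_koszulGradeSeq hx hrs).trans
    (koszulGradeSeq_le_koszulGrade fun j => ha (Ideal.subset_span (List.get_mem rs j)))

theorem koszulGrade_top : koszulGrade (⊤ : Ideal A) M = ⊤ := by
  refine ENat.eq_top_iff_forall_ge.2 fun n => le_trans ?_
    (koszulGradeSeq_le_koszulGrade (x := fun _ : Fin 1 => 1) fun _ => trivial)
  refine natCast_le_koszulGradeSeq_iff.2 fun i _ φ hφ => ?_
  simpa using smul_mem_koszulBoundaries (y := 1) (by simp [Set.range_const]) hφ

theorem eq_zero_of_forall_smul_eq_zero (h : 0 < koszulGradeSeq x M) {m : M}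
    (hm : ∀ j, x j • m = 0) : m = 0 := by
  let φ : ⋀[A]^0 (Fin r → A) →ₗ[A] M :=
    exteriorPower.alternatingMapLinearEquiv (AlternatingMap.constOfIsEmpty A _ (Fin 0) m)
  have hφ : φ ∘ₗ koszulD x 0 = 0 := by
    apply exteriorPower.linearMap_ext
    ext w : 1
    simp [φ, koszulD_ιMulti, Finset.sum_smul, mul_smul, hm]
  have h_one : ((1 : ℕ) : ℕ∞) ≤ koszulGradeSeq x M := by simpa [Order.one_le_iff_pos] using h
  have h_zero : φ = 0 := natCast_le_koszulGradeSeq_iff.1 h_one 0 one_pos φ hφ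
  simpa [φ] using LinearMap.congr_fun h_zero (exteriorPower.ιMulti A 0 Fin.elim0)

theorem eq_zero_of_pow_span_smul_eq_zero (h : 0 < koszulGradeSeq x M) {n : ℕ} {m : M}
    (hm : ∀ a ∈ Ideal.span (Set.range x) ^ n, a • m = 0) : m = 0 := by
  induction n generalizing m with
  | zero => simpa using hm 1 (by simp)
  | succ n ih =>
    refine eq_zero_of_forall_smul_eq_zero h fun j => ih fun a ha => ?_
    rw [← mul_smul]
    exact hm _ (pow_succ (Ideal.span (Set.range x)) n ▸
      Ideal.mul_mem_mul ha (Ideal.subset_span ⟨j, rfl⟩))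

end KoszulGrade

section MinimalPrimes

variable {A : Type u} [CommRing A] {I q : Ideal A}

theorem exists_mul_pow_mem_of_mem_minimalPrimes (hq : q ∈ I.minimalPrimes) {x : A} (hx : x ∈ q) :
    ∃ s ∉ q, ∃ n : ℕ, s * x ^ n ∈ I := by
  have := hq.1.1
  by_contra! h
  obtain ⟨P, hP, hIP, hdisj⟩ := Ideal.exists_le_prime_disjoint I (q.primeCompl ⊔ Submonoid.powers x)
    (Set.disjoint_left.2 fun a ha ha' => by
      obtain ⟨s, hs, _, ⟨n, rfl⟩, rfl⟩ := Submonoid.mem_sup.1 ha'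
      exact h s hs n ha)
  have hPq : P ≤ q := fun a ha => by
    by_contra haq
    exact Set.disjoint_left.1 hdisj ha (Submonoid.mem_sup_left (show a ∈ q.primeCompl from haq))
  exact Set.disjoint_left.1 hdisj (hq.2 ⟨hP, hIP⟩ hPq hx)
    (Submonoid.mem_sup_right (Submonoid.mem_powers x))

theorem exists_pow_span_mul_mem_of_mem_minimalPrimes (hq : q ∈ I.minimalPrimes) {r : ℕ}
    {x : Fin r → A} (hx : ∀ j, x j ∈ q) :
    ∃ s ∉ q, ∃ n : ℕ, ∀ a ∈ Ideal.span (Set.range x) ^ n, a * s ∈ I := by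
  have := hq.1.1
  choose s hs n hn using fun j => exists_mul_pow_mem_of_mem_minimalPrimes hq (hx j)
  have hprod : ∏ j, s j ∉ q := fun h =>
    let ⟨j, _, hj⟩ := Ideal.IsPrime.prod_mem_iff.1 h
    hs j hj
  have hrad : Ideal.span (Set.range x) ≤ (I.colon {∏ j, s j}).radical := by
    rw [Ideal.span_le]
    rintro _ ⟨j, rfl⟩
    refine ⟨n j, ?_⟩
    rw [Submodule.mem_colon_singleton, smul_eq_mul, mul_comm]
    exact Ideal.mem_of_dvd _
      (mul_dvd_mul_right (Finset.dvd_prod_of_mem s (Finset.mem_univ j)) _) (hn j)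
  obtain ⟨N, hN⟩ := Ideal.exists_pow_le_of_le_radical_of_fg hrad
    (Submodule.fg_span (Set.finite_range x))
  exact ⟨_, hprod, N, fun a ha => Submodule.mem_colon_singleton.1 (hN ha)⟩

end MinimalPrimes

section KoszulGradeBounds

variable {A : Type u} [CommRing A] {M : Type v} [AddCommGroup M] [Module A M]

theorem koszulGrade_le_quotSMulTop_add_one {y : A} (hy : IsSMulRegular M y) (a : Ideal A) :
    koszulGrade a M ≤ koszulGrade a (QuotSMulTop y M) + 1 :=
  iSup₂_le fun _ _ => iSup_le fun hx => (koszulGradeSeq_le_quotSMulTop_add_one hy).trans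
    (by gcongr; exact koszulGradeSeq_le_koszulGrade hx)

theorem koszulGrade_le_quotient_add_length {rs : List A} (hrs : IsWeaklyRegular M rs)
    (a : Ideal A) :
    koszulGrade a M ≤ koszulGrade a (M ⧸ Ideal.ofList rs • (⊤ : Submodule A M)) + rs.length :=
  iSup₂_le fun _ _ => iSup_le fun hx => (koszulGradeSeq_le_quotient_add_length hrs).trans
    (by gcongr; exact koszulGradeSeq_le_koszulGrade hx)

theorem exists_pos_koszulGradeSeq {a : Ideal A} (h : 0 < koszulGrade a M) :
    ∃ (r : ℕ) (x : Fin r → A), (∀ j, x j ∈ a) ∧ 0 < koszulGradeSeq x M := by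
  simpa only [koszulGrade, lt_iSup_iff, exists_prop] using h

theorem koszulGrade_le_of_mem_minimalPrimes {a q : Ideal A} {rs : List A}
    (hrs : IsWeaklyRegular A rs) (hq : q ∈ (Ideal.ofList rs).minimalPrimes) (haq : a ≤ q) :
    koszulGrade a A ≤ rs.length := by
  by_contra! hlt
  have hpos : 0 < koszulGrade a (A ⧸ Ideal.ofList rs • (⊤ : Submodule A A)) := by
    refine pos_iff_ne_zero.2 fun h => hlt.not_ge ?_
    simpa only [h, zero_add] using koszulGrade_le_quotient_add_length hrs a
  obtain ⟨r, x, hx, hxpos⟩ := exists_pos_koszulGradeSeq hpos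
  obtain ⟨s, hs, n, hn⟩ := exists_pow_span_mul_mem_of_mem_minimalPrimes hq fun j => haq (hx j)
  have hzero : Submodule.Quotient.mk s = (0 : A ⧸ Ideal.ofList rs • (⊤ : Submodule A A)) :=
    eq_zero_of_pow_span_smul_eq_zero hxpos fun b hb => by
      rw [← Submodule.Quotient.mk_smul, Submodule.Quotient.mk_eq_zero, smul_eq_mul, smul_eq_mul,
        Ideal.mul_top]
      exact hn b hb
  rw [Submodule.Quotient.mk_eq_zero, smul_eq_mul, Ideal.mul_top] at hzero
  exact hs (hq.1.2 hzero)

end KoszulGradeBounds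

section Unmixedness

variable {A : Type u} [CommRing A]

theorem exists_isSMulRegular_mem_of_koszulGrade_pos [IsNoetherianRing A]
    {M : Type v} [AddCommGroup M] [Module A M] [Module.Finite A M] {a : Ideal A}
    (h : 0 < koszulGrade a M) : ∃ z ∈ a, IsSMulRegular M z := by
  obtain ⟨r, x, hx, hpos⟩ := exists_pos_koszulGradeSeq h
  have hom_zero : Subsingleton ((A ⧸ a) →ₗ[A] M) := by
    refine subsingleton_of_forall_eq 0 fun f => Submodule.linearMap_qext _ (LinearMap.ext_ring ?_)
    refine eq_zero_of_forall_smul_eq_zero hpos fun j => ?_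
    rw [← map_smul, LinearMap.comp_apply, Submodule.mkQ_apply,
      (Submodule.Quotient.mk_eq_zero a).2 (by simpa using hx j), map_zero]
  simpa only [Ideal.annihilator_quotient] using IsSMulRegular.subsingleton_linearMap_iff.1 hom_zero

theorem torsionBySet_eq_bot_of_le_smul_top {M : Type v} [AddCommGroup M] [Module A M]
    [IsNoetherian A M] {z : A} (hz : z ∈ (⊥ : Ideal A).jacobson) (hreg : IsSMulRegular M z)
    {s : Set A} (hle : Submodule.torsionBySet A M s ≤ z • (⊤ : Submodule A M)) :
    Submodule.torsionBySet A M s = ⊥ := by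
  refine Submodule.eq_bot_of_le_smul_of_le_jacobson_bot (Ideal.span {z}) _
    (IsNoetherian.noetherian _) (fun n hn => ?_) (by rwa [Ideal.span_singleton_le_iff_mem])
  obtain ⟨m, -, rfl⟩ := hle hn
  refine Submodule.smul_mem_smul (Ideal.mem_span_singleton_self z)
    ((Submodule.mem_torsionBySet_iff ..).2 fun a => hreg ?_)
  have : (a : A) • z • m = 0 := (Submodule.mem_torsionBySet_iff ..).1 hn a
  simpa only [smul_zero, smul_comm z] using this

theorem notMem_of_isSMulRegular_of_mem_associatedPrimes {M : Type v} [AddCommGroup M] [Module A M]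
    [IsNoetherianRing A] {z : A} (hreg : IsSMulRegular M z) {p : Ideal A}
    (hp : p ∈ associatedPrimes A M) : z ∉ p := fun hzp => by
  have hz : z ∈ ⋃ p ∈ associatedPrimes A M, (p : Set A) := Set.mem_biUnion hp hzp
  rw [biUnion_associatedPrimes_eq_compl_regular A M] at hz
  exact hz hreg

theorem exists_le_mem_associatedPrimes_quotSMulTop [IsNoetherianRing A] {M : Type v}
    [AddCommGroup M] [Module A M] [Module.Finite A M] {z : A} (hz : z ∈ (⊥ : Ideal A).jacobson)
    (hreg : IsSMulRegular M z) {p : Ideal A} (hp : p ∈ associatedPrimes A M) :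
    ∃ q ∈ associatedPrimes A (QuotSMulTop z M), p ≤ q ∧ z ∈ q := by
  obtain ⟨hprime, m, hm⟩ := isAssociatedPrime_iff.1 hp
  have mem_iff (a : A) : a ∈ p ↔ a • m = 0 := by
    rw [hm, Submodule.mem_colon_singleton, Submodule.mem_bot]
  have torsion_ne_bot : Submodule.torsionBySet A M p ≠ ⊥ := fun hbot => by
    have hm0 : m ∈ Submodule.torsionBySet A M p :=
      (Submodule.mem_torsionBySet_iff ..).2 fun a => (mem_iff a).1 a.2
    rw [hbot, Submodule.mem_bot] at hm0
    exact hprime.ne_top ((Ideal.eq_top_iff_one p).2 ((mem_iff 1).2 (by rw [hm0, smul_zero])))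
  obtain ⟨n, hn, hnz⟩ := SetLike.not_le_iff_exists.1
    (mt (torsionBySet_eq_bot_of_le_smul_top hz hreg) torsion_ne_bot)
  obtain ⟨q, hq, hle⟩ := exists_le_isAssociatedPrime_of_isNoetherianRing A
    ((z • (⊤ : Submodule A M)).mkQ n) (by simpa using hnz)
  refine ⟨q, hq, fun a ha => hle ?_, hle ?_⟩
  · rw [Submodule.mem_colon_singleton, ← map_smul,
      (Submodule.mem_torsionBySet_iff ..).1 hn ⟨a, ha⟩, map_zero]
    exact zero_mem _
  · rw [Submodule.mem_colon_singleton, ← map_smul, Submodule.mem_bot, Submodule.mkQ_apply,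
      Submodule.Quotient.mk_eq_zero]
    exact Submodule.smul_mem_pointwise_smul _ _ _ trivial

theorem natCast_le_ringKrullDim_quotient_of_mem_associatedPrimes [IsLocalRing A]
    [IsNoetherianRing A] {M : Type v} [AddCommGroup M] [Module A M] [Module.Finite A M] {n : ℕ}
    (hn : (n : ℕ∞) ≤ koszulGrade (maximalIdeal A) M) {p : Ideal A}
    (hp : p ∈ associatedPrimes A M) : (n : WithBot ℕ∞) ≤ ringKrullDim (A ⧸ p) := by
  have := hp.1
  induction n generalizing M p with
  | zero => exact ringKrullDim_nonneg_of_nontrivial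
  | succ n ih =>
    obtain ⟨z, hz, hreg⟩ := exists_isSMulRegular_mem_of_koszulGrade_pos
      (lt_of_lt_of_le (by simp) hn)
    obtain ⟨q, hq, hpq, hzq⟩ := exists_le_mem_associatedPrimes_quotSMulTop
      (maximalIdeal_le_jacobson _ hz) hreg hp
    have hdim : (n : WithBot ℕ∞) ≤ ringKrullDim (A ⧸ q) := by
      refine ih ?_ hq hq.1
      have := hn.trans (koszulGrade_le_quotSMulTop_add_one hreg _)
      rwa [Nat.cast_succ, ENat.add_le_add_iff_right ENat.one_ne_top] at this
    calc ((n + 1 : ℕ) : WithBot ℕ∞) = n + 1 := by push_cast; rfl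
      _ ≤ ringKrullDim (A ⧸ q) + 1 := add_le_add_left hdim 1
      _ ≤ ringKrullDim (A ⧸ p) :=
        ringKrullDim_succ_le_of_surjective (Ideal.Quotient.factor hpq)
          (Ideal.Quotient.factor_surjective hpq) (r := Ideal.Quotient.mk p z)
          (mem_nonZeroDivisors_of_ne_zero (mt Ideal.Quotient.eq_zero_iff_mem.1
            (notMem_of_isSMulRegular_of_mem_associatedPrimes hreg hp)))
          (by rwa [Ideal.Quotient.factor_mk, Ideal.Quotient.eq_zero_iff_mem])

theorem koszulGrade_le_ringKrullDim_quotient_of_mem_associatedPrimes [IsLocalRing A]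
    [IsNoetherianRing A] {M : Type v} [AddCommGroup M] [Module A M] [Module.Finite A M]
    {p : Ideal A} (hp : p ∈ associatedPrimes A M) :
    (koszulGrade (maximalIdeal A) M : WithBot ℕ∞) ≤ ringKrullDim (A ⧸ p) := by
  have := hp.1
  obtain ⟨d, hd⟩ := WithBot.ne_bot_iff_exists.1
    (ne_bot_of_le_ne_bot WithBot.coe_ne_bot (ringKrullDim_nonneg_of_nontrivial (R := A ⧸ p)))
  rw [← hd, WithBot.coe_le_coe]
  refine ENat.forall_natCast_le_iff_le.1 fun n hn => WithBot.coe_le_coe.1 ?_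
  rw [hd]
  exact natCast_le_ringKrullDim_quotient_of_mem_associatedPrimes hn hp

theorem ringKrullDim_quotient_add_height_le (J : Ideal A) :
    ringKrullDim (A ⧸ J) + J.height ≤ ringKrullDim A := by
  by_cases hJ : J = ⊤
  · rw [hJ, ringKrullDim_eq_bot_of_subsingleton]
    simp only [Ideal.height_top, WithBot.bot_add, bot_le]
  have hne : Nonempty (PrimeSpectrum.zeroLocus (R := A) J) := by
    rwa [Set.nonempty_coe_sort, Set.nonempty_iff_ne_empty, ne_eq,
      PrimeSpectrum.zeroLocus_empty_iff_eq_top]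
  have : Nonempty (PrimeSpectrum A) := ⟨hne.some.1⟩
  rw [ringKrullDim_quotient, Order.krullDim_eq_iSup_length, ringKrullDim,
    Order.krullDim_eq_iSup_height_add_coheight_of_nonempty, ← WithBot.coe_add, WithBot.coe_le_coe,
    ENat.iSup_add, iSup_le_iff]
  intro l
  refine le_trans ?_ (le_iSup _ l.head.1)
  rw [add_comm, ← PrimeSpectrum.height_eq_orderHeight]
  gcongr
  · exact l.head.2
  · exact Order.length_le_coheight (p := l.map Subtype.val fun _ _ h => h) le_rfl

theorem ringKrullDim_quotient_le_ringKrullDim_quotient_sup_span_singleton_add_one [IsLocalRing A]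
    [IsNoetherianRing A] (J : Ideal A) {y : A} (hy : y ∈ maximalIdeal A) :
    ringKrullDim (A ⧸ J) ≤ ringKrullDim (A ⧸ J ⊔ Ideal.span {y}) + 1 := by
  have mem_jacobson : Ideal.Quotient.mk J y ∈ Ring.jacobson (A ⧸ J) := by
    rw [Ring.jacobson_eq_sInf_isMaximal, Submodule.mem_sInf]
    intro (P : Ideal (A ⧸ J)) (hP : P.IsMaximal)
    have := Ideal.comap_isMaximal_of_surjective (Ideal.Quotient.mk J)
      Ideal.Quotient.mk_surjective (K := P)
    rwa [← Ideal.mem_comap, eq_maximalIdeal this]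
  have hle := ringKrullDim_le_ringKrullDim_quotient_add_encard {Ideal.Quotient.mk J y}
    (Set.singleton_subset_iff.2 mem_jacobson)
  rwa [Set.encard_singleton, ← Set.image_singleton, ← Ideal.map_span,
    ringKrullDim_eq_of_ringEquiv (DoubleQuot.quotQuotEquivQuotSup J (Ideal.span {y}))] at hle

theorem ringKrullDim_quotient_ofList_take_add_le [IsLocalRing A] [IsNoetherianRing A]
    {ys : List A} (hne : Ideal.ofList ys ≠ ⊤)
    (hht : (ys.length : ℕ∞) ≤ (Ideal.ofList ys).height) {i : ℕ} (hi : i ≤ ys.length) :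
    ringKrullDim (A ⧸ Ideal.ofList (ys.take i)) + i ≤ ringKrullDim A := by
  induction hi using Nat.decreasingInduction with
  | self =>
    rw [List.take_length]
    refine le_trans ?_ (ringKrullDim_quotient_add_height_le (Ideal.ofList ys))
    gcongr
    exact_mod_cast hht
  | of_succ i hi ih =>
    rw [List.take_succ_eq_append_getElem hi, Ideal.ofList_append, Ideal.ofList_singleton] at ih
    refine le_trans ?_ ih
    have hmem : ys[i] ∈ maximalIdeal A :=
      le_maximalIdeal hne (Ideal.subset_span (List.getElem_mem hi))
    calc ringKrullDim (A ⧸ Ideal.ofList (ys.take i)) + i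
        ≤ ringKrullDim (A ⧸ Ideal.ofList (ys.take i) ⊔ Ideal.span {ys[i]}) + 1 + i :=
          add_le_add_left
            (ringKrullDim_quotient_le_ringKrullDim_quotient_sup_span_singleton_add_one _ hmem) _
      _ = _ := by push_cast; rw [add_assoc, add_comm 1]

theorem exists_mem_associatedPrimes_of_not_isSMulRegular [IsNoetherianRing A] {M : Type v}
    [AddCommGroup M] [Module A M] {y : A} (hy : ¬IsSMulRegular M y) :
    ∃ p ∈ associatedPrimes A M, y ∈ p := by
  have : y ∈ ⋃ p ∈ associatedPrimes A M, (p : Set A) := by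
    rwa [biUnion_associatedPrimes_eq_compl_regular A M]
  simpa only [Set.mem_iUnion, exists_prop, SetLike.mem_coe] using this

theorem koszulGrade_le_ringKrullDim_quotient_of_not_isSMulRegular [IsLocalRing A]
    [IsNoetherianRing A] {J : Ideal A} {y : A}
    (hy : ¬IsSMulRegular (A ⧸ (J • ⊤ : Submodule A A)) y) :
    (koszulGrade (maximalIdeal A) (A ⧸ (J • ⊤ : Submodule A A)) : WithBot ℕ∞) ≤
      ringKrullDim (A ⧸ J ⊔ Ideal.span {y}) := by
  obtain ⟨p, hp, hyp⟩ := exists_mem_associatedPrimes_of_not_isSMulRegular hy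
  have hJp : J ≤ p := by
    have := IsAssociatedPrime.annihilator_le hp
    rwa [Submodule.annihilator_top, smul_eq_mul, Ideal.mul_top, Ideal.annihilator_quotient] at this
  have hle : J ⊔ Ideal.span {y} ≤ p :=
    sup_le hJp ((Ideal.span_singleton_le_iff_mem p).2 hyp)
  exact (koszulGrade_le_ringKrullDim_quotient_of_mem_associatedPrimes hp).trans
    (ringKrullDim_le_of_surjective (Ideal.Quotient.factor hle)
      (Ideal.Quotient.factor_surjective hle))

theorem isWeaklyRegular_of_length_le_height [IsLocalRing A] [IsNoetherianRing A]
    (hA : (maximalIdeal A).height ≤ koszulGrade (maximalIdeal A) A) {ys : List A}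
    (hne : Ideal.ofList ys ≠ ⊤) (hht : (ys.length : ℕ∞) ≤ (Ideal.ofList ys).height) :
    IsWeaklyRegular A ys := by
  suffices ∀ i ≤ ys.length, IsWeaklyRegular A (ys.take i) by
    simpa only [List.take_length] using this _ le_rfl
  intro i hi
  induction i with
  | zero => exact .nil A A
  | succ i ih =>
    have hpre := ih (i.le_succ.trans hi)
    rw [List.take_succ_eq_append_getElem hi, isWeaklyRegular_append_iff,
      isWeaklyRegular_singleton_iff]
    refine ⟨hpre, by_contra fun hy => ?_⟩
    have grade_le := koszulGrade_le_ringKrullDim_quotient_of_not_isSMulRegular hy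
    have le_grade := hA.trans (koszulGrade_le_quotient_add_length hpre (maximalIdeal A))
    have dim_le := ringKrullDim_quotient_ofList_take_add_le hne hht hi
    rw [List.take_succ_eq_append_getElem hi, Ideal.ofList_append, Ideal.ofList_singleton,
      ← maximalIdeal_height_eq_ringKrullDim (R := A)] at dim_le
    rw [List.length_take_of_le (i.le_succ.trans hi)] at le_grade
    generalize ringKrullDim (A ⧸ Ideal.ofList (ys.take i) ⊔ Ideal.span {ys[i]}) = d
      at grade_le dim_le
    obtain ⟨d, rfl⟩ := WithBot.ne_bot_iff_exists.1
      (ne_bot_of_le_ne_bot WithBot.coe_ne_bot grade_le)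
    norm_cast at grade_le dim_le
    have hlt := (dim_le.trans le_grade).trans (add_le_add_left grade_le _)
    lift d to ℕ using
      ne_top_of_le_ne_top Ideal.height_ne_top_of_isPrime (le_self_add.trans dim_le)
    norm_cast at hlt
    omega

end Unmixedness

section RegularLocalRing

variable {A : Type u} [CommRing A]

theorem exists_isPrime_natCast_le_ringKrullDim_quotient {n : ℕ} (h : n ≤ ringKrullDim A) :
    ∃ Q : Ideal A, Q.IsPrime ∧ n ≤ ringKrullDim (A ⧸ Q) := by
  obtain ⟨l, hl⟩ := Order.le_krullDim_iff.1 h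
  refine ⟨l.head.asIdeal, l.head.isPrime, ?_⟩
  rw [ringKrullDim_quotient, ← hl]
  change _ ≤ Order.krullDim (Set.Ici l.head)
  rw [← Order.coheight_eq_krullDim_Ici]
  exact WithBot.coe_le_coe.2 (Order.length_le_coheight le_rfl)

theorem map_maximalIdeal_of_surjective {B : Type v} [CommRing B] [IsLocalRing A] [IsLocalRing B]
    (f : A →+* B) (hf : Function.Surjective f) : (maximalIdeal A).map f = maximalIdeal B := by
  have := IsLocalHom.of_surjective f hf
  have ne_top : (maximalIdeal A).map f ≠ ⊤ := fun htop =>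
    (maximalIdeal.isMaximal B).ne_top (top_le_iff.1 (htop ▸ map_maximalIdeal_le f))
  exact eq_maximalIdeal ((Ideal.map_eq_top_or_isMaximal_of_surjective f hf
    (maximalIdeal.isMaximal A)).resolve_left ne_top)

theorem ofList_map_quotientMk_eq_maximalIdeal [IsLocalRing A] {x : A} {rs : List A}
    (hrs : Ideal.ofList (x :: rs) = maximalIdeal A) [IsLocalRing (A ⧸ Ideal.span {x})] :
    Ideal.ofList (rs.map (Ideal.Quotient.mk (Ideal.span {x}))) =
      maximalIdeal (A ⧸ Ideal.span {x}) := by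
  rw [← map_maximalIdeal_of_surjective _ Ideal.Quotient.mk_surjective, ← hrs, Ideal.map_ofList,
    List.map_cons, Ideal.ofList_cons,
    Ideal.Quotient.eq_zero_iff_mem.2 (Ideal.mem_span_singleton_self x),
    Ideal.span_singleton_zero, bot_sup_eq]

theorem exists_ofList_eq_of_fg {I : Ideal A} (hI : I.FG) :
    ∃ xs : List A, Ideal.ofList xs = I ∧ xs.length = I.spanFinrank := by
  have hfin := Submodule.FG.finite_generators hI
  refine ⟨hfin.toFinset.toList, ?_, ?_⟩
  · simp only [Ideal.ofList, Finset.mem_toList, Set.Finite.mem_toFinset]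
    exact I.span_generators
  · rw [Finset.length_toList, ← Set.ncard_eq_toFinset_card _ hfin, Submodule.FG.generators_ncard hI]

theorem spanFinrank_ofList_le_length (xs : List A) :
    (Ideal.ofList xs).spanFinrank ≤ xs.length := by
  classical
  have hcoe : {x | x ∈ xs} = (xs.toFinset : Set A) := by simp
  rw [Ideal.ofList, hcoe]
  refine (Submodule.spanFinrank_span_le_ncard_of_finite xs.toFinset.finite_toSet).trans ?_
  rw [Set.ncard_coe_finset]
  exact xs.toFinset_card_le

theorem eq_bot_of_isPrime_le_span_singleton [IsLocalRing A] [IsNoetherianRing A] {x : A}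
    (hx : x ∈ maximalIdeal A) {Q : Ideal A} [hQ : Q.IsPrime] (hxQ : x ∉ Q)
    (hle : Q ≤ Ideal.span {x}) : Q = ⊥ := by
  refine Submodule.eq_bot_of_le_smul_of_le_jacobson_bot (Ideal.span {x}) Q
    (IsNoetherian.noetherian _) (fun a ha => ?_) ?_
  · obtain ⟨b, rfl⟩ := Ideal.mem_span_singleton'.1 (hle ha)
    rw [smul_eq_mul, mul_comm b]
    exact Ideal.mul_mem_mul (Ideal.mem_span_singleton_self x)
      ((hQ.mem_or_mem ha).resolve_right hxQ)
  · exact (Ideal.span_singleton_le_iff_mem _).2 (maximalIdeal_le_jacobson _ hx)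

theorem isDomain_of_isDomain_quotient_span_singleton [IsLocalRing A] [IsNoetherianRing A] {x : A}
    (hx : x ∈ maximalIdeal A) [IsDomain (A ⧸ Ideal.span {x})] {n : ℕ}
    (hdim : ((n + 1 : ℕ) : WithBot ℕ∞) ≤ ringKrullDim A)
    (hdim' : ringKrullDim (A ⧸ Ideal.span {x}) ≤ n) : IsDomain A ∧ x ≠ 0 := by
  obtain ⟨Q, hQ, hQdim⟩ := exists_isPrime_natCast_le_ringKrullDim_quotient hdim
  have hxQ : x ∉ Q := fun hxQ => by
    have := hQdim.trans ((ringKrullDim_le_of_surjective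
      (Ideal.Quotient.factor ((Ideal.span_singleton_le_iff_mem Q).2 hxQ))
      (Ideal.Quotient.factor_surjective _)).trans hdim')
    norm_cast at this
    omega
  have hle : Q ≤ Ideal.span {x} := by
    by_contra hnle
    obtain ⟨q, hqQ, hqx⟩ := SetLike.not_le_iff_exists.1 hnle
    have := ringKrullDim_succ_le_of_surjective
      (Ideal.Quotient.factor (le_sup_right : Ideal.span {x} ≤ Q ⊔ Ideal.span {x}))
      (Ideal.Quotient.factor_surjective _) (r := Ideal.Quotient.mk _ q)
      (mem_nonZeroDivisors_of_ne_zero (mt Ideal.Quotient.eq_zero_iff_mem.1 hqx))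
      (by rw [Ideal.Quotient.factor_mk, Ideal.Quotient.eq_zero_iff_mem]
          exact Ideal.mem_sup_left hqQ)
    have := hQdim.trans ((ringKrullDim_quotient_le_ringKrullDim_quotient_sup_span_singleton_add_one
      Q hx).trans (this.trans hdim'))
    norm_cast at this
    omega
  obtain rfl := eq_bot_of_isPrime_le_span_singleton hx hxQ hle
  exact ⟨IsDomain.of_bot_isPrime A, hxQ⟩

theorem isDomain_and_isWeaklyRegular_of_ofList_eq_maximalIdeal {n : ℕ} {A : Type u} [CommRing A]
    [IsLocalRing A] [IsNoetherianRing A] {rs : List A} (hrs : Ideal.ofList rs = maximalIdeal A)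
    (hlen : rs.length = n) (hdim : n ≤ ringKrullDim A) : IsDomain A ∧ IsWeaklyRegular A rs := by
  induction n generalizing A with
  | zero =>
    obtain rfl := List.length_eq_zero_iff.1 hlen
    rw [Ideal.ofList_nil] at hrs
    exact ⟨(isField_iff_maximalIdeal_eq.2 hrs.symm).isDomain, .nil A A⟩
  | succ n ih =>
    obtain ⟨x, rs, rfl⟩ := List.exists_cons_of_length_eq_add_one hlen
    have hx : x ∈ maximalIdeal A := hrs ▸ Ideal.subset_span List.mem_cons_self
    have : Nontrivial (A ⧸ Ideal.span {x}) :=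
      Ideal.Quotient.nontrivial_iff.2 (ne_top_of_le_ne_top (maximalIdeal.isMaximal A).ne_top
        ((Ideal.span_singleton_le_iff_mem _).2 hx))
    have : IsLocalRing (A ⧸ Ideal.span {x}) := .of_surjective' _ Ideal.Quotient.mk_surjective
    have hmax := ofList_map_quotientMk_eq_maximalIdeal hrs
    have hlen' : (rs.map (Ideal.Quotient.mk (Ideal.span {x}))).length = n := by
      simpa using hlen
    have dim_le : ringKrullDim (A ⧸ Ideal.span {x}) ≤ n := by
      refine (ringKrullDim_le_spanFinrank_maximalIdeal _).trans ?_
      rw [← hmax, ← hlen']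
      exact_mod_cast spanFinrank_ofList_le_length _
    have le_dim : (n : WithBot ℕ∞) ≤ ringKrullDim (A ⧸ Ideal.span {x}) := by
      have hle := Ideal.height_le_ringKrullDim_quotient_add_one hx
      rw [maximalIdeal_height_eq_ringKrullDim] at hle
      replace hle := hdim.trans hle
      rw [Nat.cast_succ] at hle
      exact ENat.WithBot.add_le_add_one_right_iff.1 hle
    obtain ⟨hdom, hreg⟩ := ih hmax hlen' le_dim
    obtain ⟨hdomA, hx0⟩ := isDomain_of_isDomain_quotient_span_singleton hx hdim dim_le
    refine ⟨hdomA, .cons (.of_ne_zero hx0) ?_⟩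
    rw [LinearEquiv.isWeaklyRegular_congr (Submodule.quotEquivOfEq (x • (⊤ : Submodule A A))
      (Ideal.span {x}) (by rw [← Submodule.ideal_span_singleton_smul]; simp)),
      ← isWeaklyRegular_map_algebraMap_iff (A ⧸ Ideal.span {x})]
    exact hreg

theorem height_maximalIdeal_le_koszulGrade_of_isRegularLocalRing (A : Type u) [CommRing A]
    [IsRegularLocalRing A] : (maximalIdeal A).height ≤ koszulGrade (maximalIdeal A) A := by
  obtain ⟨rs, hrs, hlen⟩ := exists_ofList_eq_of_fg (IsNoetherian.noetherian (maximalIdeal A))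
  have hdim : (rs.length : WithBot ℕ∞) = ringKrullDim A := by
    rw [hlen, IsRegularLocalRing.spanFinrank_maximalIdeal]
  obtain ⟨-, hreg⟩ := isDomain_and_isWeaklyRegular_of_ofList_eq_maximalIdeal hrs rfl hdim.le
  rw [← maximalIdeal_height_eq_ringKrullDim] at hdim
  rw [← WithBot.coe_injective hdim]
  exact length_le_koszulGrade hrs.le hreg

end RegularLocalRing

section Spectrum

theorem le_height_iff {A : Type u} [CommRing A] {I : Ideal A} {n : ℕ∞} :
    n ≤ I.height ↔ ∀ P : Ideal A, P.IsPrime → I ≤ P → n ≤ P.height := by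
  refine ⟨fun h P _ hP => h.trans (Ideal.height_mono hP), fun h => ?_⟩
  rw [Ideal.height_eq_inf_minimalPrimes]
  exact le_iInf₂ fun P hP => h P hP.1.1 hP.1.2

theorem finite_minimalPrimes_of_noetherianSpace {A : Type u} [CommRing A]
    [NoetherianSpace (PrimeSpectrum A)] (I : Ideal A) : I.minimalPrimes.Finite := by
  obtain ⟨Z, hfin, -, hirr, hZ⟩ :=
    NoetherianSpace.exists_finite_set_isClosed_irreducible
      (PrimeSpectrum.isClosed_zeroLocus (I : Set A))
  refine (hfin.image PrimeSpectrum.vanishingIdeal).subset fun q hq => ?_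
  obtain ⟨z, hz, hqz⟩ : (⟨q, hq.1.1⟩ : PrimeSpectrum A) ∈ ⋃₀ Z := hZ ▸ hq.1.2
  have hIz : I ≤ PrimeSpectrum.vanishingIdeal z := by
    rw [← PrimeSpectrum.subset_zeroLocus_iff_le_vanishingIdeal, hZ]
    exact Set.subset_sUnion_of_mem hz
  have hzq : PrimeSpectrum.vanishingIdeal z ≤ q := fun a ha =>
    PrimeSpectrum.mem_vanishingIdeal z a |>.1 ha _ hqz
  exact ⟨z, hz, le_antisymm hzq
    (hq.2 ⟨PrimeSpectrum.isIrreducible_iff_vanishingIdeal_isPrime.1 (hirr z hz), hIz⟩ hzq)⟩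

variable {R : Type u} {S : Type v} [CommRing R] [CommRing S] {f : R →+* S}

/-- A homeomorphism between prime spectra preserves specialization, that is, inclusion of
primes. -/
def orderIsoOfIsHomeomorphComap (hf : IsHomeomorph (PrimeSpectrum.comap f)) :
    PrimeSpectrum S ≃o PrimeSpectrum R where
  toEquiv := (hf.homeomorph _).toEquiv
  map_rel_iff' {P Q} := by
    rw [PrimeSpectrum.le_iff_specializes, PrimeSpectrum.le_iff_specializes]
    exact hf.isInducing.specializes_iff

theorem height_comap_of_isHomeomorph_comap (hf : IsHomeomorph (PrimeSpectrum.comap f))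
    (P : Ideal S) [hP : P.IsPrime] : (P.comap f).height = P.height := by
  have h := Order.height_orderIso (orderIsoOfIsHomeomorphComap hf) ⟨P, hP⟩
  rw [← PrimeSpectrum.height_eq_orderHeight, ← PrimeSpectrum.height_eq_orderHeight] at h
  exact h

theorem height_map_of_isHomeomorph_comap (hf : IsHomeomorph (PrimeSpectrum.comap f))
    (I : Ideal R) : (I.map f).height = I.height := by
  refine eq_of_forall_le_iff fun n => ?_
  rw [le_height_iff, le_height_iff]
  refine ⟨fun h Q hQ hIQ => ?_, fun h P hP hIP => ?_⟩
  · obtain ⟨P, hP⟩ := hf.surjective ⟨Q, hQ⟩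
    obtain rfl : P.asIdeal.comap f = Q := congrArg PrimeSpectrum.asIdeal hP
    rw [height_comap_of_isHomeomorph_comap hf]
    exact h _ P.isPrime (Ideal.map_le_iff_le_comap.2 hIQ)
  · rw [← height_comap_of_isHomeomorph_comap hf]
    exact h _ inferInstance (Ideal.map_le_iff_le_comap.1 hIP)

theorem finiteRingKrullDim_of_isHomeomorph_comap (hf : IsHomeomorph (PrimeSpectrum.comap f))
    [FiniteRingKrullDim R] : FiniteRingKrullDim S := by
  refine Order.finiteDimensionalOrder_iff_krullDim_ne_bot_and_top.2 ?_
  rw [Order.krullDim_eq_of_orderIso (orderIsoOfIsHomeomorphComap hf)]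
  exact Order.finiteDimensionalOrder_iff_krullDim_ne_bot_and_top.1 inferInstance

theorem isHomeomorph_comap_of_isPRadical (i : R →+* S) (p : ℕ) [ExpChar R p] [IsPRadical i p] :
    IsHomeomorph (PrimeSpectrum.comap i) :=
  PrimeSpectrum.isHomeomorph_comap i
    (fun s =>
      let ⟨n, t, ht⟩ := IsPRadical.pow_mem i p s
      ⟨p ^ n, expChar_pow_pos R p n, t, ht⟩)
    ((IsPRadical.ker_le i p).trans pNilradical_le_nilradical)

end Spectrum

section Frobenius

theorem isWeaklyRegular_self_iff {A : Type u} [CommRing A] {rs : List A} :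
    IsWeaklyRegular A rs ↔ ∀ (j : ℕ) (h : j < rs.length) (s : A),
      rs[j] * s ∈ Ideal.ofList (rs.take j) → s ∈ Ideal.ofList (rs.take j) := by
  rw [isWeaklyRegular_iff]
  refine forall₂_congr fun j hj => ?_
  rw [smul_eq_mul, Ideal.mul_top]
  exact isSMulRegular_quotient_iff_mem_of_smul_mem _ _

theorem radical_map_iterateFrobenius {A : Type u} [CommRing A] (p : ℕ) [ExpChar A p] (e : ℕ)
    (I : Ideal A) : (I.map (iterateFrobenius A p e)).radical = I.radical := by
  refine le_antisymm (Ideal.radical_mono (Ideal.map_le_iff_le_comap.2 fun a ha => ?_))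
    (Ideal.radical_le_radical_iff.2 fun a ha => ⟨p ^ e, ?_⟩)
  · rw [Ideal.mem_comap, iterateFrobenius_def]
    exact Ideal.pow_mem_of_mem _ ha _ (expChar_pow_pos A p e)
  · rw [← iterateFrobenius_def]
    exact Ideal.mem_map_of_mem _ ha

theorem height_radical {A : Type u} [CommRing A] (I : Ideal A) : I.radical.height = I.height := by
  rw [Ideal.height_eq_inf_minimalPrimes, Ideal.height_eq_inf_minimalPrimes,
    Ideal.radical_minimalPrimes]

theorem height_map_iterateFrobenius {A : Type u} [CommRing A] (p : ℕ) [ExpChar A p] (e : ℕ)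
    (I : Ideal A) : (I.map (iterateFrobenius A p e)).height = I.height := by
  rw [← height_radical, radical_map_iterateFrobenius, height_radical]

theorem map_iterateFrobenius_ne_top {A : Type u} [CommRing A] (p : ℕ) [ExpChar A p] (e : ℕ)
    {I : Ideal A} (hI : I ≠ ⊤) : I.map (iterateFrobenius A p e) ≠ ⊤ := by
  rwa [Ne, ← Ideal.radical_eq_top, radical_map_iterateFrobenius, Ideal.radical_eq_top]

variable {R : Type u} {S : Type v} [CommRing R] [CommRing S] (i : R →+* S) (p : ℕ)

theorem eventually_exists_eq_pow [IsPRadical i p] (s : S) :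
    ∀ᶠ e in atTop, ∃ t, i t = s ^ p ^ e := by
  obtain ⟨n, t, ht⟩ := IsPRadical.pow_mem i p s
  filter_upwards [eventually_ge_atTop n] with e he
  refine ⟨t ^ p ^ (e - n), ?_⟩
  rw [map_pow, ht, ← pow_mul, ← pow_add, Nat.add_sub_cancel' he]

variable [ExpChar S p]

theorem eventually_exists_map_eq_map_iterateFrobenius [IsPRadical i p] (xs : List S) :
    ∀ᶠ e in atTop, ∃ rs : List R, rs.map i = xs.map (iterateFrobenius S p e) := by
  induction xs with
  | nil => exact Eventually.of_forall fun e => ⟨[], rfl⟩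
  | cons x xs ih =>
    filter_upwards [ih, eventually_exists_eq_pow i p x] with e ⟨rs, hrs⟩ ⟨t, ht⟩
    exact ⟨t :: rs, by rw [List.map_cons, List.map_cons, hrs, ht, iterateFrobenius_def]⟩

variable [ExpChar R p]

theorem eventually_exists_mem_map_iterateFrobenius [IsPRadical i p] {I : Ideal R} {s : S}
    (hs : s ∈ I.map i) :
    ∀ᶠ e in atTop, ∃ t ∈ I.map (iterateFrobenius R p e), i t = s ^ p ^ e := by
  induction hs using Submodule.span_induction with
  | mem s hs =>
    obtain ⟨t, ht, rfl⟩ := hs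
    exact Eventually.of_forall fun e =>
      ⟨t ^ p ^ e, Ideal.mem_map_of_mem (iterateFrobenius R p e) ht, map_pow _ _ _⟩
  | zero =>
    exact Eventually.of_forall fun e => ⟨0, zero_mem _, by
      rw [map_zero, zero_pow (expChar_pow_pos R p e).ne']⟩
  | add s s' _ _ h h' =>
    filter_upwards [h, h'] with e ⟨t, ht, hts⟩ ⟨t', ht', hts'⟩
    exact ⟨t + t', add_mem ht ht', by rw [map_add, hts, hts', add_pow_expChar_pow]⟩
  | smul c s _ h =>
    filter_upwards [h, eventually_exists_eq_pow i p c] with e ⟨t, ht, hts⟩ ⟨c', hc'⟩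
    exact ⟨c' * t, Ideal.mul_mem_left _ _ ht, by rw [map_mul, hts, hc', smul_eq_mul, mul_pow]⟩

variable {i p} in
theorem mem_map_of_mem_map_iterateFrobenius [PerfectRing S p] {I : Ideal R} {e : ℕ} {s : S} {t : R}
    (ht : t ∈ I.map (iterateFrobenius R p e)) (hts : i t = s ^ p ^ e) : s ∈ I.map i := by
  have hmap : (I.map (iterateFrobenius R p e)).map i =
      (I.map i).map (iterateFrobeniusEquiv S p e : S →+* S) := by
    rw [Ideal.map_map, Ideal.map_map]
    exact congrArg I.map (i.iterateFrobenius_comm p e)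
  have hmem : s ^ p ^ e ∈ (I.map i).map (iterateFrobeniusEquiv S p e : S →+* S) :=
    hmap ▸ hts ▸ Ideal.mem_map_of_mem i ht
  obtain ⟨s', hs', hs's⟩ := (Ideal.mem_map_of_equiv (iterateFrobeniusEquiv S p e) _).1 hmem
  rwa [← (iterateFrobeniusEquiv S p e).injective hs's]

theorem mem_map_of_mul_mem_map_of_isPRadical [IsPRadical i p] [PerfectRing S p] {I : Ideal R}
    {r : R}
    (h : ∀ (e : ℕ) (t : R), r ^ p ^ e * t ∈ I.map (iterateFrobenius R p e) →
      t ∈ I.map (iterateFrobenius R p e)) {s : S} (hs : i r * s ∈ I.map i) : s ∈ I.map i := by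
  obtain ⟨e, ⟨t, ht, hts⟩, t', hts'⟩ :=
    ((eventually_exists_mem_map_iterateFrobenius i p hs).and
      (eventually_exists_eq_pow i p s)).exists
  obtain ⟨n, hn⟩ : ∃ n, (r ^ p ^ e * t') ^ p ^ n = t ^ p ^ n := by
    refine sub_mem_pNilradical_iff_pow_expChar_pow_eq.1 (IsPRadical.ker_le i p ?_)
    rw [RingHom.mem_ker, map_sub, map_mul, map_pow, hts', hts, mul_pow, sub_self]
  have hmem : t ^ p ^ n ∈ I.map (iterateFrobenius R p (n + e)) := by
    rw [iterateFrobenius_add, ← Ideal.map_map, ← iterateFrobenius_def]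
    exact Ideal.mem_map_of_mem _ ht
  refine mem_map_of_mem_map_iterateFrobenius (t := t' ^ p ^ n) (h (n + e) _ ?_) ?_
  · rwa [add_comm n e, pow_add, pow_mul, ← mul_pow, hn, add_comm e n]
  · rw [map_pow, hts', ← pow_mul, ← pow_add, add_comm]

theorem isWeaklyRegular_map_of_isPRadical [IsPRadical i p] [PerfectRing S p] {rs : List R}
    (hrs : ∀ e, IsWeaklyRegular R (rs.map (iterateFrobenius R p e))) :
    IsWeaklyRegular S (rs.map i) := by
  rw [isWeaklyRegular_self_iff]
  intro j hj s hs
  rw [← List.map_take, ← Ideal.map_ofList] at hs ⊢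
  rw [List.getElem_map] at hs
  refine mem_map_of_mul_mem_map_of_isPRadical i p (fun e t ht => ?_) hs
  rw [Ideal.map_ofList, List.map_take] at ht ⊢
  refine isWeaklyRegular_self_iff.1 (hrs e) j (by simpa using hj) t ?_
  rwa [List.getElem_map, iterateFrobenius_def]

end Frobenius

section PerfectExtension

/-- Every finite sequence that generates a proper ideal of height at least its length is weakly
regular. For Noetherian local rings this is the Cohen–Macaulay property; unlike grade and depth
conditions, it passes to perfect closures directly. -/
def ParametersAreRegular (A : Type u) [CommRing A] : Prop :=
  ∀ xs : List A, Ideal.ofList xs ≠ ⊤ → (xs.length : ℕ∞) ≤ (Ideal.ofList xs).height →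
    IsWeaklyRegular A xs

theorem isWeaklyRegular_map_ringEquiv_iff {A : Type u} {B : Type v} [CommRing A] [CommRing B]
    (e : A ≃+* B) {xs : List A} :
    IsWeaklyRegular B (xs.map e) ↔ IsWeaklyRegular A xs :=
  (e.toAddEquiv.isWeaklyRegular_congr (List.forall₂_map_right_iff.2 <|
    List.forall₂_same.2 fun a _ s => map_mul e a s)).symm

variable {R : Type u} {S : Type v} [CommRing R] [CommRing S]

theorem ParametersAreRegular.of_isPRadical (i : R →+* S) (p : ℕ) [ExpChar R p] [ExpChar S p]
    [IsPRadical i p] [PerfectRing S p] (hR : ParametersAreRegular R) : ParametersAreRegular S := by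
  intro xs hne hht
  obtain ⟨e, rs, hrs⟩ := (eventually_exists_map_eq_map_iterateFrobenius i p xs).exists
  have hmap : (Ideal.ofList rs).map i = (Ideal.ofList xs).map (iterateFrobenius S p e) := by
    rw [Ideal.map_ofList, Ideal.map_ofList, hrs]
  have hheight : (Ideal.ofList rs).height = (Ideal.ofList xs).height := by
    rw [← height_map_of_isHomeomorph_comap (isHomeomorph_comap_of_isPRadical i p), hmap,
      height_map_iterateFrobenius]
  have hlength : rs.length = xs.length := by simpa using congrArg List.length hrs
  have hne' : Ideal.ofList rs ≠ ⊤ := fun h =>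
    map_iterateFrobenius_ne_top p e hne (by rw [← hmap, h, Ideal.map_top])
  have hreg : IsWeaklyRegular S (rs.map i) := isWeaklyRegular_map_of_isPRadical i p fun n => by
    refine hR _ ?_ ?_
    · rw [← Ideal.map_ofList]
      exact map_iterateFrobenius_ne_top p n hne'
    · rwa [← Ideal.map_ofList, height_map_iterateFrobenius, List.length_map, hheight, hlength]
  rw [hrs] at hreg
  exact (isWeaklyRegular_map_ringEquiv_iff (iterateFrobeniusEquiv S p e)).1 hreg

end PerfectExtension

section CechTop

variable {A : Type u} [CommRing A]

theorem mem_range_cechRestrict {r : ℕ} {x : Fin r → A} {I J : Finset (Fin r)} (h : I ⊆ J) {n : ℕ}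
    {z : CechTerm x J} {c : A}
    (hz : algebraMap A _ (∏ i ∈ I, x i) ^ n * z = algebraMap A _ c) :
    z ∈ (cechRestrict x h).range := by
  obtain ⟨v, hv⟩ :=
    ((IsLocalization.Away.algebraMap_isUnit (S := CechTerm x I) (∏ i ∈ I, x i)).pow n
      ).exists_left_inv
  refine ⟨v * algebraMap A _ c, ?_⟩
  rw [AlgHom.toRingHom_eq_coe, RingHom.coe_coe, map_mul, AlgHom.commutes, ← hz, ← mul_assoc,
    ← AlgHom.commutes (cechRestrict x h), ← map_pow, ← map_mul, hv, map_one, one_mul]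

theorem mem_range_cechRestrict_erase {r : ℕ} {x : Fin r → A} {j l : Fin r} (hlj : l ≠ j) {n : ℕ}
    {b : A} {g ξ : CechTerm x Finset.univ}
    (hb : algebraMap A (CechTerm x Finset.univ) (∏ i, x i) ^ n * g = algebraMap A _ b)
    (hξ : algebraMap A (CechTerm x Finset.univ) (x l) * ξ = 1) (M : ℕ) :
    algebraMap A (CechTerm x Finset.univ) (x j) ^ n * g * ξ ^ M ∈
      (cechRestrict x (Finset.erase_subset j Finset.univ)).range := by
  obtain ⟨w, hw⟩ : x l ∣ ∏ i ∈ Finset.univ.erase j, x i :=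
    Finset.dvd_prod_of_mem x (Finset.mem_erase.2 ⟨hlj, Finset.mem_univ _⟩)
  refine mem_range_cechRestrict _ (n := n + M) (c := b * w ^ M) ?_
  let φ := algebraMap A (CechTerm x Finset.univ)
  have hφ : φ (∏ i, x i) = φ (x j) * φ (∏ i ∈ Finset.univ.erase j, x i) := by
    rw [← map_mul, Finset.mul_prod_erase _ _ (Finset.mem_univ _)]
  calc φ (∏ i ∈ Finset.univ.erase j, x i) ^ (n + M) * (φ (x j) ^ n * g * ξ ^ M)
      = φ (∏ i, x i) ^ n * g * (φ (x l * w) * ξ) ^ M := by rw [← hw, hφ]; ring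
    _ = φ b * φ w ^ M := by rw [hb, map_mul, mul_right_comm, hξ, one_mul]
    _ = φ (b * w ^ M) := by rw [map_mul, map_pow]

variable {k : ℕ} {x : Fin (k + 1) → A}

theorem cechCochain_top_ext {f g : CechCochain x (k + 1)}
    (h : f ⟨Finset.univ, by simp⟩ = g ⟨Finset.univ, by simp⟩) : f = g := by
  funext ⟨I, hI⟩
  obtain rfl : I = Finset.univ := Finset.card_eq_iff_eq_univ I |>.1 (by simpa using hI)
  exact h

theorem cechD_single_univ (j : Fin (k + 1)) (h : CechTerm x (Finset.univ.erase j)) :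
    cechD x k (Pi.single (M := fun I : {I : Finset (Fin (k + 1)) // I.card = k} => CechTerm x I.1)
        ⟨Finset.univ.erase j, by simp⟩ h) ⟨Finset.univ, by simp⟩ =
      (-1 : ℤ) ^ ({i ∈ Finset.univ | i < j} : Finset (Fin (k + 1))).card •
        cechRestrict x (Finset.erase_subset j Finset.univ) h := by
  rw [cechD, LinearMap.pi_apply, LinearMap.sum_apply,
    Finset.sum_eq_single ⟨j, Finset.mem_univ j⟩]
  · simp
  · rintro ⟨j', hj'⟩ - hne
    have hne' : (⟨Finset.univ.erase j', by simp⟩ : {I : Finset (Fin (k + 1)) // I.card = k}) ≠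
        ⟨Finset.univ.erase j, by simp⟩ := fun heq =>
      hne (Subtype.ext (Finset.erase_injOn Finset.univ (Finset.mem_univ _) (Finset.mem_univ _)
        (congrArg Subtype.val heq)))
    simp [Pi.single_eq_of_ne hne']
  · exact fun h => absurd (Finset.mem_univ _) h

theorem mem_range_cechD_of_eq_sum {f : CechCochain x (k + 1)}
    (z : Fin (k + 1) → CechTerm x Finset.univ)
    (hz : ∀ j, z j ∈ (cechRestrict x (Finset.erase_subset j Finset.univ)).range)
    (hf : f ⟨Finset.univ, by simp⟩ = ∑ j, z j) : f ∈ LinearMap.range (cechD x k) := by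
  choose h hh using hz
  refine ⟨∑ j, (-1 : ℤ) ^ ({i ∈ Finset.univ | i < j} : Finset (Fin (k + 1))).card •
    Pi.single (M := fun I : {I : Finset (Fin (k + 1)) // I.card = k} => CechTerm x I.1)
        ⟨Finset.univ.erase j, by simp⟩ (h j), cechCochain_top_ext ?_⟩
  rw [hf, map_sum, Finset.sum_apply]
  refine Finset.sum_congr rfl fun j _ => ?_
  rw [map_zsmul, Pi.smul_apply, cechD_single_univ, smul_smul, ← mul_pow, ← hh]
  simp

theorem exists_mem_range_cechRestrict_sum_eq_pow_smul {s b : A} {m M n : ℕ} {a : Fin k → A}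
    {g : CechTerm x Finset.univ}
    (hb : algebraMap A (CechTerm x Finset.univ) (∏ j, x j) ^ n * g = algebraMap A _ b)
    (ha : ∑ j, a j * x j.castSucc ^ n = s ^ m * x (Fin.last k) ^ M) :
    ∃ z : Fin (k + 1) → CechTerm x Finset.univ,
      (∀ j, z j ∈ (cechRestrict x (Finset.erase_subset j Finset.univ)).range) ∧
        ∑ j, z j = s ^ m • g := by
  let φ := algebraMap A (CechTerm x Finset.univ)
  obtain ⟨ξ, hξ⟩ : ∃ ξ, φ (x (Fin.last k)) * ξ = 1 :=
    (isUnit_of_dvd_unit (map_dvd φ (Finset.dvd_prod_of_mem x (Finset.mem_univ _)))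
      (IsLocalization.Away.algebraMap_isUnit _)).exists_right_inv
  refine ⟨Fin.lastCases 0 fun j => a j • (φ (x j.castSucc) ^ n * g * ξ ^ M), fun j => ?_, ?_⟩
  · induction j using Fin.lastCases with
    | last =>
      simp only [Fin.lastCases_last]
      exact zero_mem _
    | cast j =>
      simp only [Fin.lastCases_castSucc]
      exact Subalgebra.smul_mem _
        (mem_range_cechRestrict_erase (Fin.castSucc_lt_last j).ne' hb hξ M) _
  · have hξM : φ (x (Fin.last k)) ^ M * ξ ^ M = 1 := by rw [← mul_pow, hξ, one_pow]
    calc ∑ j, (Fin.lastCases 0 fun j => a j • (φ (x j.castSucc) ^ n * g * ξ ^ M) :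
            Fin (k + 1) → CechTerm x Finset.univ) j
        = φ (∑ j, a j * x j.castSucc ^ n) * g * ξ ^ M := by
          simp only [Fin.sum_univ_castSucc, Fin.lastCases_castSucc, Fin.lastCases_last, add_zero,
            Algebra.smul_def, map_sum, map_mul, map_pow, Finset.sum_mul, mul_assoc, φ]
      _ = s ^ m • g := by
          rw [ha, map_mul, map_pow φ (x _), Algebra.smul_def]
          linear_combination φ (s ^ m) * g * hξM

theorem exists_pow_smul_cechCohomology_eq_zero {s : A} {N : ℕ}
    (hs : s * x (Fin.last k) ^ N ∈ Ideal.span (Set.range fun j : Fin k => x j.castSucc))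
    (c : CechCohomology x (k + 1)) : ∃ m : ℕ, s ^ m • c = 0 := by
  obtain ⟨⟨f, hf⟩, rfl⟩ := Submodule.mkQ_surjective _ c
  obtain ⟨n, b, hb⟩ := IsLocalization.Away.surj (∏ j, x j) (f ⟨Finset.univ, by simp⟩)
  have hrad : Ideal.span (Set.range fun j : Fin k => x j.castSucc) ≤
      (Ideal.span (Set.range fun j : Fin k => x j.castSucc ^ n)).radical := by
    rw [Ideal.span_le]
    rintro _ ⟨j, rfl⟩
    exact ⟨n, Ideal.subset_span ⟨j, rfl⟩⟩
  obtain ⟨m, hm⟩ := hrad hs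
  obtain ⟨a, ha⟩ := Ideal.mem_span_range_iff_exists_fun.1 hm
  rw [mul_pow, ← pow_mul] at ha
  refine ⟨m, ?_⟩
  rw [← map_smul, Submodule.mkQ_apply, Submodule.Quotient.mk_eq_zero]
  obtain ⟨z, hz, hsum⟩ := exists_mem_range_cechRestrict_sum_eq_pow_smul
    ((mul_comm _ _).trans hb) ha
  exact mem_range_cechD_of_eq_sum z hz hsum.symm

theorem subsingleton_localizedModule_cechCohomology {P : Ideal A} [P.IsPrime] {s : A} {N : ℕ}
    (hsP : s ∉ P)
    (hs : s * x (Fin.last k) ^ N ∈ Ideal.span (Set.range fun j : Fin k => x j.castSucc)) :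
    Subsingleton (LocalizedModule P.primeCompl (CechCohomology x (k + 1))) := by
  rw [LocalizedModule.subsingleton_iff]
  intro c
  obtain ⟨m, hm⟩ := exists_pow_smul_cechCohomology_eq_zero hs c
  exact ⟨s ^ m, pow_mem (S := P.primeCompl) hsP m, hm⟩

end CechTop

section Senses

variable {A : Type u} [CommRing A]

theorem koszulGrade_eq_length_of_mem_minimalPrimes {xs : List A} (hxs : IsWeaklyRegular A xs)
    {a q : Ideal A} (hxa : Ideal.ofList xs ≤ a) (haq : a ≤ q)
    (hq : q ∈ (Ideal.ofList xs).minimalPrimes) : koszulGrade a A = xs.length :=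
  le_antisymm (koszulGrade_le_of_mem_minimalPrimes hxs hq haq) (length_le_koszulGrade hxa hxs)

theorem exists_mem_forall_notMem_minimalPrimes [NoetherianSpace (PrimeSpectrum A)] {a b : Ideal A}
    {s : Set (Ideal A)} (hs : s ⊆ b.minimalPrimes) (h : ∀ P ∈ s, ¬ a ≤ P) :
    ∃ z ∈ a, ∀ P ∈ s, z ∉ P := by
  have hfin : s.Finite := (finite_minimalPrimes_of_noetherianSpace b).subset hs
  by_contra! hcover
  obtain ⟨P, hP, haP⟩ := (Ideal.subset_union_prime (s := hfin.toFinset) (f := id) ⊤ ⊤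
    (fun Q hQ _ _ => (hs (hfin.mem_toFinset.1 hQ)).1.1) (I := a)).1 fun z hz => by
      simpa only [Set.mem_iUnion, SetLike.mem_coe, Finset.mem_coe, hfin.mem_toFinset, id,
        exists_prop] using hcover z hz
  exact h P (hfin.mem_toFinset.1 hP) haP

theorem exists_mem_add_one_le_height_sup [NoetherianSpace (PrimeSpectrum A)] {a b : Ideal A}
    {n : ℕ∞} (hn : n ≤ b.height) (h : ∀ P ∈ b.minimalPrimes, P.height ≤ n → ¬ a ≤ P) :
    ∃ z ∈ a, n + 1 ≤ (b ⊔ Ideal.span {z}).height := by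
  obtain ⟨z, hza, hz⟩ := exists_mem_forall_notMem_minimalPrimes
    (Set.sep_subset b.minimalPrimes fun P => P.height ≤ n) fun P hP => h P hP.1 hP.2
  refine ⟨z, hza, le_height_iff.2 fun P hP hbP => ?_⟩
  obtain ⟨Q, hQ, hQP⟩ := Ideal.exists_minimalPrimes_le (le_sup_left.trans hbP)
  have := hQ.1.1
  rcases lt_or_ge n Q.height with hlt | hle
  · exact (Order.add_one_le_of_lt hlt).trans (Ideal.height_mono hQP)
  · have hzP : z ∈ P := hbP (Ideal.mem_sup_right (Ideal.mem_span_singleton_self z))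
    have hQP' : Q < P := hQP.lt_of_ne fun heq => hz Q ⟨hQ, hle⟩ (heq ▸ hzP)
    exact (add_le_add_left (hn.trans (Ideal.height_mono hQ.1.2)) 1).trans
      (Ideal.height_add_one_le_of_lt_of_isPrime hQP')

theorem ofList_concat (xs : List A) (z : A) :
    Ideal.ofList (xs ++ [z]) = Ideal.ofList xs ⊔ Ideal.span {z} := by
  rw [Ideal.ofList_append, Ideal.ofList_singleton]

theorem mem_of_pow_mul_mem_ofList {xs : List A} {z : A} (hreg : IsWeaklyRegular A (xs ++ [z]))
    {n : ℕ} {t : A} (ht : z ^ n * t ∈ Ideal.ofList xs) : t ∈ Ideal.ofList xs := by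
  have hz (t : A) (ht : z * t ∈ Ideal.ofList xs) : t ∈ Ideal.ofList xs := by
    have h := isWeaklyRegular_self_iff.1 hreg xs.length (by simp) t
    simp only [List.take_left', List.getElem_concat_length] at h
    exact h ht
  induction n with
  | zero => rwa [pow_zero, one_mul] at ht
  | succ n ih => exact ih (hz _ (by rwa [pow_succ', mul_assoc] at ht))

theorem mem_weaklyAssociatedPrimes_quotient_iff {a q : Ideal A} :
    q ∈ weaklyAssociatedPrimes A (A ⧸ a) ↔ ∃ s : A, q ∈ (a.colon {s}).minimalPrimes := by
  refine (Ideal.Quotient.mk_surjective.exists).trans (exists_congr fun s => ?_)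
  suffices LinearMap.ker (LinearMap.toSpanSingleton A (A ⧸ a) (Ideal.Quotient.mk a s)) =
      a.colon {s} by rw [this]
  ext t
  rw [LinearMap.mem_ker, LinearMap.toSpanSingleton_apply, Submodule.mem_colon_singleton,
    ← Ideal.Quotient.eq_zero_iff_mem]
  rfl

theorem minimalPrimes_subset_weaklyAssociatedPrimes (a : Ideal A) :
    a.minimalPrimes ⊆ weaklyAssociatedPrimes A (A ⧸ a) := by
  refine fun q hq => mem_weaklyAssociatedPrimes_quotient_iff.2 ⟨1, ?_⟩
  convert hq
  ext t
  rw [Submodule.mem_colon_singleton, smul_eq_mul, mul_one]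

theorem exists_ofList_le_length_le_height [NoetherianSpace (PrimeSpectrum A)] {a : Ideal A} {n : ℕ}
    (hn : (n : ℕ∞) ≤ a.height) :
    ∃ xs : List A, Ideal.ofList xs ≤ a ∧ xs.length = n ∧ (n : ℕ∞) ≤ (Ideal.ofList xs).height := by
  induction n with
  | zero => exact ⟨[], by simp⟩
  | succ n ih =>
    push_cast at hn
    obtain ⟨xs, hxa, hlen, hht⟩ := ih (le_self_add.trans hn)
    obtain ⟨z, hza, hz⟩ := exists_mem_add_one_le_height_sup (a := a) hht fun P _ hPn haP =>
      (ENat.lt_add_one_iff (ENat.natCast_ne_top n)).2 hPn |>.not_ge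
        (hn.trans (Ideal.height_mono haP))
    refine ⟨xs ++ [z], ?_, by simp [hlen], ?_⟩
    · rw [ofList_concat]
      exact sup_le hxa ((Ideal.span_singleton_le_iff_mem _).2 hza)
    · rw [ofList_concat]
      exact_mod_cast hz

theorem le_height_of_isStrongParameterSequence [FiniteRingKrullDim A] {l : ℕ} {x : Fin l → A}
    (hx : IsStrongParameterSequence x) (k : ℕ) (hk : k ≤ l) :
    (k : ℕ∞) ≤ (Ideal.span (Set.range fun j : Fin k => x (Fin.castLE hk j))).height := by
  induction k with
  | zero => simp
  | succ k ih =>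
    refine le_height_iff.2 fun P hP hle => ?_
    by_contra! hlt
    have hPk : P.height ≤ k := ENat.lt_natCast_add_one_iff.1 (by simpa using hlt)
    have hle' : Ideal.span (Set.range fun j : Fin k => x (Fin.castLE (Nat.le_of_succ_le hk) j)) ≤
        P := by
      refine (Ideal.span_mono ?_).trans hle
      rintro _ ⟨j, rfl⟩
      exact ⟨j.castSucc, rfl⟩
    have hmin := Ideal.mem_minimalPrimes_of_height_le hle' (hPk.trans (ih _))
    obtain ⟨s, hs, N, hsN⟩ := exists_mul_pow_mem_of_mem_minimalPrimes hmin
      (hle (Ideal.subset_span ⟨Fin.last k, rfl⟩))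
    have := subsingleton_localizedModule_cechCohomology
      (x := fun j : Fin (k + 1) => x (Fin.castLE hk j)) hs hsN
    have := (hx (k + 1) hk (Nat.succ_pos k)).cech_ne_zero P hle
    exact not_subsingleton (LocalizedModule P.primeCompl (CechCohomology _ (k + 1))) ‹_›

namespace ParametersAreRegular

theorem isHamiltonMarleyCM [FiniteRingKrullDim A] (hA : ParametersAreRegular A) :
    IsHamiltonMarleyCM A := by
  intro l x hx
  have hspan : Ideal.ofList (List.ofFn x) = Ideal.span (Set.range x) := by
    simp only [Ideal.ofList, List.mem_ofFn']
    rfl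
  have hne : Ideal.ofList (List.ofFn x) ≠ ⊤ := by
    rw [hspan]
    rcases Nat.eq_zero_or_pos l with rfl | hl
    · have : Nontrivial A := Nontrivial.of_finiteRingKrullDim
      simp
    · exact (hx l le_rfl hl).span_ne_top
  refine ⟨hA _ hne ?_, ?_⟩
  · rw [hspan, List.length_ofFn]
    exact le_height_of_isStrongParameterSequence hx l le_rfl
  · rw [smul_eq_mul, Ideal.mul_top]
    exact hne.symm

variable [NoetherianSpace (PrimeSpectrum A)]

theorem exists_isWeaklyRegular_length_eq_height [FiniteRingKrullDim A]
    (hA : ParametersAreRegular A) {a : Ideal A} (ha : a ≠ ⊤) :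
    ∃ xs : List A, Ideal.ofList xs ≤ a ∧ IsWeaklyRegular A xs ∧ (xs.length : ℕ∞) = a.height ∧
      (Ideal.ofList xs).height = a.height := by
  obtain ⟨n, hn⟩ := ENat.ne_top_iff_exists.1 (Ideal.height_ne_top ha)
  obtain ⟨xs, hxa, rfl, hht⟩ := exists_ofList_le_length_le_height hn.le
  exact ⟨xs, hxa, hA xs (ne_top_of_le_ne_top ha hxa) hht, hn,
    (Ideal.height_mono hxa).antisymm (hn ▸ hht)⟩

theorem height_eq_koszulGrade [FiniteRingKrullDim A] (hA : ParametersAreRegular A) (a : Ideal A) :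
    a.height = koszulGrade a A := by
  by_cases ha : a = ⊤
  · rw [ha, Ideal.height_top, koszulGrade_top]
  obtain ⟨xs, hxa, hreg, hlen, hht⟩ := hA.exists_isWeaklyRegular_length_eq_height ha
  obtain ⟨P, hP, haP, hPa⟩ := Ideal.exists_isPrime_height_eq hlen.symm
  have hmin : P ∈ (Ideal.ofList xs).minimalPrimes :=
    Ideal.mem_minimalPrimes_of_height_le (hxa.trans haP) (by rw [hPa, hlen, hht])
  rw [koszulGrade_eq_length_of_mem_minimalPrimes hreg hxa haP hmin, hlen]

theorem isGlazCM [FiniteRingKrullDim A] (hA : ParametersAreRegular A) : IsGlazCM A := by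
  intro P hP
  obtain ⟨xs, hxP, hreg, hlen, hht⟩ := hA.exists_isWeaklyRegular_length_eq_height hP.ne_top
  have hmin : P ∈ (Ideal.ofList xs).minimalPrimes :=
    Ideal.mem_minimalPrimes_of_height_le hxP hht.ge
  let L := Localization.AtPrime P
  have hmin' : P.map (algebraMap A L) ∈
      (Ideal.ofList (xs.map (algebraMap A L))).minimalPrimes := by
    rwa [← Ideal.map_ofList, Localization.AtPrime.map_eq_maximalIdeal,
      IsLocalization.minimalPrimes_map P.primeCompl, Set.mem_preimage,
      Localization.AtPrime.under_maximalIdeal]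
  rw [koszulGrade_eq_length_of_mem_minimalPrimes (hreg.of_isLocalization L P.primeCompl) hmin'.1.2
    le_rfl hmin', List.length_map, hlen]

theorem isWeakBourbakiUnmixed (hA : ParametersAreRegular A) : IsWeakBourbakiUnmixed A := by
  intro a hfg hht
  refine Set.Subset.antisymm (minimalPrimes_subset_weaklyAssociatedPrimes a) fun q hq => ?_
  obtain ⟨s, hqs⟩ := mem_weaklyAssociatedPrimes_quotient_iff.1 hq
  have haq : a ≤ q := Ideal.le_colon.trans hqs.1.2
  by_contra hmin
  obtain ⟨z, hzq, hz⟩ : ∃ z ∈ q, (a.spanFinrank : ℕ∞) + 1 ≤ (a ⊔ Ideal.span {z}).height :=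
    exists_mem_add_one_le_height_sup hht fun P hP _ hqP =>
      hmin (hqP.antisymm (hP.2 ⟨hqs.1.1, haq⟩ hqP) ▸ hP)
  obtain ⟨xs, rfl, hlen⟩ := exists_ofList_eq_of_fg hfg
  have hreg : IsWeaklyRegular A (xs ++ [z]) := by
    refine hA _ (ne_top_of_le_ne_top hqs.1.1.ne_top ?_) ?_ <;> rw [ofList_concat]
    · exact sup_le haq ((Ideal.span_singleton_le_iff_mem _).2 hzq)
    · rw [List.length_append, hlen]
      exact_mod_cast hz
  obtain ⟨t, htq, n, htn⟩ := exists_mul_pow_mem_of_mem_minimalPrimes hqs hzq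
  rw [Submodule.mem_colon_singleton, smul_eq_mul, mul_comm t, mul_assoc] at htn
  exact htq (hqs.1.2 (Submodule.mem_colon_singleton.2 (mem_of_pow_mul_mem_ofList hreg htn)))

end ParametersAreRegular

end Senses

end NonNoetherianCM

end

open NonNoetherianCM in
theorem theorem4p5_general {R S : Type*} [CommRing R] [IsLocalRing R] [IsNoetherianRing R]
    (hR : (IsLocalRing.maximalIdeal R).height ≤ koszulGrade (IsLocalRing.maximalIdeal R) R)
    [CommRing S] (i : R →+* S) (p : ℕ) [ExpChar R p] [ExpChar S p] [IsPRadical i p]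
    [PerfectRing S p] :
    IsHamiltonMarleyCM S ∧ IsGlazCM S ∧ IsWeakBourbakiUnmixed S ∧
      ∀ 𝒜 : Set (Ideal S), IsCMInSenseOf 𝒜 := by
  have hS : ParametersAreRegular S :=
    ParametersAreRegular.of_isPRadical i p fun _ => isWeaklyRegular_of_length_le_height hR
  have hSpec := isHomeomorph_comap_of_isPRadical i p
  have := hSpec.isInducing.noetherianSpace
  have := finiteRingKrullDim_of_isHomeomorph_comap hSpec
  exact ⟨hS.isHamiltonMarleyCM, hS.isGlazCM, hS.isWeakBourbakiUnmixed,
    fun _ a _ => hS.height_eq_koszulGrade a⟩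

theorem theorem4p5 (p : ℕ) [Fact p.Prime] (R : Type*) [CommRing R] [CharP R p]
    [IsRegularLocalRing R] :
    NonNoetherianCM.IsHamiltonMarleyCM (PerfectClosure R p) ∧
    NonNoetherianCM.IsGlazCM (PerfectClosure R p) ∧
    NonNoetherianCM.IsWeakBourbakiUnmixed (PerfectClosure R p) ∧
    (∀ 𝒜 : Set (Ideal (PerfectClosure R p)), 𝒜.Nonempty → NonNoetherianCM.IsCMInSenseOf 𝒜) ∧
    NonNoetherianCM.IsCMInSenseOf {q : Ideal (PerfectClosure R p) | q.IsPrime} ∧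
    NonNoetherianCM.IsCMInSenseOf {q : Ideal (PerfectClosure R p) | q.IsMaximal} ∧
    NonNoetherianCM.IsCMInSenseOf (Set.univ : Set (Ideal (PerfectClosure R p))) ∧
    NonNoetherianCM.IsCMInSenseOf {a : Ideal (PerfectClosure R p) | a.FG} := by
  obtain ⟨hHM, hGlaz, hBourbaki, hCM⟩ := theorem4p5_general
    (NonNoetherianCM.height_maximalIdeal_le_koszulGrade_of_isRegularLocalRing R)
    (PerfectClosure.of R p) p
  exact ⟨hHM, hGlaz, hBourbaki, fun 𝒜 _ => hCM 𝒜, hCM _, hCM _, hCM _, hCM _⟩
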